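/- Let $n\ge 0$ and let $\mathbb T=\mathbb R\cup\{-\infty\}$, with ordinary addition ($-\infty$ absorbing) and the topology of the half-open interval $[-\infty,\infty)$. **Planar networks.** A planar network $\Gamma$ is a finite graph embedded in a strip $\{a\le x\le b\}\subset\mathbb R^2$, $a<b$, whose edges are straight segments not parallel to the $y$-axis, oriented from left to right. Vertices on $\{x=a\}$ are sources, vertices on $\{x=b\}$ are sinks, the others are internal. A weighting is an element $\epsilon\in\mathbb T^{E\Gamma}$; the weight of a subgraph is the sum of the weights of its edges. An $i$-path is a subgraph that is the union of $i$ pairwise vertex-disjoint directed paths, each leading from a source to a sink. Put $l_0\Gamma(\epsilon)=0$ and, for $i>0$, let $l_i\Gamma(\epsilon)\in\mathbb T$ be the maximal weight of an $i$-path of $\Gamma$ ($-\infty$ if there is none). The network $\Gamma$ has rank $n$ if it has exactly $n$ sources and $n$ sinks, in both cases with $y$-coordinates $1,\dots,n$. Then $\Gamma^{(k)}$ denotes the maximal subgraph of $\Gamma$ containing no source and no sink with $y$-coordinate greater than $k$, and $$L\Gamma:\mathbb T^{E\Gamma}\to\mathbb T^{\{(k,i)\,:\,0\le i\le k\le n\}},\qquad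 (L\Gamma(\epsilon))^k_i=l_i\Gamma^{(k)}(\epsilon).$$ **The triangular network $\Gamma_0=\Gamma_0[n]$.** It consists of $n$ horizontal lines at heights $1,\dots,n$, line $j$ joining source $j$ to sink $j$, and, for $1\le r\le n-1$, of $r$ slanted edges $a_{r,1},\dots,a_{r,r}$, ordered from left to right, each descending from an internal vertex on line $r+1$ to an internal vertex on line $r$; all these endpoints are distinct, and there are no other internal vertices. On line $j$ with $2\le j\le n-1$ the internal vertices alternate from left to right: the lower end of $a_{j,1}$, the upper end of $a_{j-1,1}$, the lower end of $a_{j,2}$, the upper end of $a_{j-1,2}$, …, the upper end of $a_{j-1,j-1}$, the lower end of $a_{j,j}$. If $n\ge2$, line $n$ carries only the upper ends of $a_{n-1,1},\dots,a_{n-1,n-1}$ and line $1$ only the lower end of $a_{1,1}$. Successive vertices of each line are joined by horizontal edges. **The cone.** Let $\mathcal C_2$ be the set of real tableaux $(t^k_i)_{0\le i\le k\le n}$ such that, for all $0<i\le k<n$, $$t^{k+1}_i+t^k_{i-1}\ \ge\ t^{k+1}_{i-1}+t^k_i,\qquad t^{k+1}_i+t^k_i\ \ge\ t^{k+1}_{i+1}+t^k_{i-1}.$$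 **Theorem.** For every $n$, $$\operatorname{im}(L\Gamma_0[n])=\overline{\mathcal C_2}\cap\{t^k_0=0\mid k=0,\dots,n\},$$ where $\overline{\mathcal C_2}$ is the closure of $\mathcal C_2$ in $\mathbb T^{\{(k,i)\,:\,0\le i\le k\le n\}}$ with the product topology. -/

import Mathlib

/-- The tropical numbers `ℝ ∪ {-∞}`, written with ordinary addition (`-∞` is absorbing) and
maximum (`⊔`). As a topological space it carries the order topology, i.e. it is the half-open
interval `[-∞, ∞)`. -/
abbrev TropReal : Type := WithBot ℝ

/-- A planar network: a finite graph with vertex set `V` and edge set `E`, embedded into the strip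
`a ≤ x ≤ b` of the plane so that every edge is a straight segment that is not parallel to the
`y`-axis. The vertices are labelled by elements of a type `α`. An edge is recorded as the pair of
its left and its right endpoint, so edges are oriented from left to right. -/
structure PlanarNetwork (α : Type*) where
  /-- the vertices -/
  V : Finset α
  /-- the edges, oriented from left to right -/
  E : Finset (α × α)
  /-- the position of a vertex in the plane -/
  pos : α → ℝ × ℝ
  /-- the left boundary of the strip -/
  a : ℝ
  /-- the right boundary of the strip -/
  b : ℝ
  a_lt_b : a < b
  ends_mem : ∀ e ∈ E, e.1 ∈ V ∧ e.2 ∈ V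
  pos_injOn : Set.InjOn pos V
  strip : ∀ v ∈ V, a ≤ (pos v).1 ∧ (pos v).1 ≤ b
  left_to_right : ∀ e ∈ E, (pos e.1).1 < (pos e.2).1
  vertex_on_edge : ∀ e ∈ E, ∀ v ∈ V, pos v ∈ segment ℝ (pos e.1) (pos e.2) → v = e.1 ∨ v = e.2
  edges_noncrossing : ∀ e ∈ E, ∀ f ∈ E, e ≠ f →
    ∀ p ∈ segment ℝ (pos e.1) (pos e.2), p ∈ segment ℝ (pos f.1) (pos f.2) →
      ∃ v, (v = e.1 ∨ v = e.2) ∧ (v = f.1 ∨ v = f.2) ∧ p = pos v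

namespace PlanarNetwork

variable {α : Type*}

/-- Sources are the vertices on the line `x = a`. -/
def IsSource (Γ : PlanarNetwork α) (v : α) : Prop := v ∈ Γ.V ∧ (Γ.pos v).1 = Γ.a

/-- Sinks are the vertices on the line `x = b`. -/
def IsSink (Γ : PlanarNetwork α) (v : α) : Prop := v ∈ Γ.V ∧ (Γ.pos v).1 = Γ.b

/-- A network has rank `n` if it has exactly `n` sources and `n` sinks, and the set of
`y`-coordinates of the sources, as well as that of the sinks, is `{1, …, n}`. -/
def HasRank (Γ : PlanarNetwork α) (n : ℕ) : Prop :=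
  (fun v => (Γ.pos v).2) '' {v | Γ.IsSource v} = (fun j : ℕ => (j : ℝ)) '' Set.Icc 1 n ∧
  (fun v => (Γ.pos v).2) '' {v | Γ.IsSink v} = (fun j : ℕ => (j : ℝ)) '' Set.Icc 1 n

/-- A pair (set of vertices, set of edges) is a subnetwork if it is a subgraph. -/
def IsSubnetwork (Γ : PlanarNetwork α) (S : Finset α × Finset (α × α)) : Prop :=
  S.1 ⊆ Γ.V ∧ S.2 ⊆ Γ.E ∧ ∀ e ∈ S.2, e.1 ∈ S.1 ∧ e.2 ∈ S.1

open scoped Classical in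
/-- The number of edges in `F` that end in `v`. -/
noncomputable def inDegree (F : Finset (α × α)) (v : α) : ℕ := (F.filter (fun e => e.2 = v)).card

open scoped Classical in
/-- The number of edges in `F` that start in `v`. -/
noncomputable def outDegree (F : Finset (α × α)) (v : α) : ℕ := (F.filter (fun e => e.1 = v)).card

/-- Multipaths: subnetworks in which every vertex that is internal in `Γ` has degree `(1,1)`, every
source degree `(0,1)` and every sink degree `(1,0)`. Since `Γ` is oriented from left to right, these
are exactly the unions of pairwise disjoint paths leading from a source to a sink. -/
def IsMultipath (Γ : PlanarNetwork α) (S : Finset α × Finset (α × α)) : Prop :=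
  Γ.IsSubnetwork S ∧ ∀ v ∈ S.1,
    (Γ.IsSource v → inDegree S.2 v = 0 ∧ outDegree S.2 v = 1) ∧
    (Γ.IsSink v → inDegree S.2 v = 1 ∧ outDegree S.2 v = 0) ∧
    (¬ Γ.IsSource v → ¬ Γ.IsSink v → inDegree S.2 v = 1 ∧ outDegree S.2 v = 1)

open scoped Classical in
/-- The set of `i`-paths of `Γ`: the multipaths with exactly `i` sources. -/
noncomputable def paths (Γ : PlanarNetwork α) (i : ℕ) : Finset (Finset α × Finset (α × α)) :=
  (Γ.V.powerset ×ˢ Γ.E.powerset).filter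
    (fun S => Γ.IsMultipath S ∧ (S.1.filter Γ.IsSource).card = i)

/-- A weighting assigns a tropical number to each edge. -/
abbrev Weighting (Γ : PlanarNetwork α) : Type _ := {e : α × α // e ∈ Γ.E} → TropReal

open scoped Classical in
/-- The weight of a subnetwork is the sum of the weights of its edges. -/
noncomputable def weight (Γ : PlanarNetwork α) (ε : Γ.Weighting)
    (S : Finset α × Finset (α × α)) : TropReal :=
  ∑ e ∈ Finset.univ.filter (fun e : {e : α × α // e ∈ Γ.E} => (e : α × α) ∈ S.2), ε e

/-- The functional `l_i`: the maximal weight of an `i`-path, `-∞` if there is no `i`-path, with the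
convention `l_0 = 0`. -/
noncomputable def l (Γ : PlanarNetwork α) (i : ℕ) (ε : Γ.Weighting) : TropReal :=
  if i = 0 then 0 else (Γ.paths i).sup (Γ.weight ε)

/-- The vertices that are neither a source nor a sink with `y`-coordinate above `k`. -/
def KeptBy (Γ : PlanarNetwork α) (k : ℕ) (v : α) : Prop :=
  ¬ ((Γ.IsSource v ∨ Γ.IsSink v) ∧ (k : ℝ) < (Γ.pos v).2)

open scoped Classical in
/-- The network `Γ^(k)`: the maximal subgraph of `Γ` that contains no source and no sink with
`y`-coordinate above `k`. -/
noncomputable def trunc (Γ : PlanarNetwork α) (k : ℕ) : PlanarNetwork α where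
  V := Γ.V.filter (fun v : α => Γ.KeptBy k v)
  E := Γ.E.filter (fun e : α × α => Γ.KeptBy k e.1 ∧ Γ.KeptBy k e.2)
  pos := Γ.pos
  a := Γ.a
  b := Γ.b
  a_lt_b := Γ.a_lt_b
  ends_mem := fun e he => by
    rw [Finset.mem_filter] at he
    exact ⟨Finset.mem_filter.2 ⟨(Γ.ends_mem e he.1).1, he.2.1⟩,
      Finset.mem_filter.2 ⟨(Γ.ends_mem e he.1).2, he.2.2⟩⟩
  pos_injOn := Γ.pos_injOn.mono (fun v hv => (Finset.mem_filter.1 hv).1)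
  strip := fun v hv => Γ.strip v (Finset.mem_filter.1 hv).1
  left_to_right := fun e he => Γ.left_to_right e (Finset.mem_filter.1 he).1
  vertex_on_edge := fun e he v hv =>
    Γ.vertex_on_edge e (Finset.mem_filter.1 he).1 v (Finset.mem_filter.1 hv).1
  edges_noncrossing := fun e he f hf =>
    Γ.edges_noncrossing e (Finset.mem_filter.1 he).1 f (Finset.mem_filter.1 hf).1

theorem trunc_E_subset (Γ : PlanarNetwork α) (k : ℕ) : (Γ.trunc k).E ⊆ Γ.E :=
  by classical exact fun _ he => (Finset.mem_filter.1 he).1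

/-- The restriction of a weighting of `Γ` to `Γ^(k)`. -/
def restrict (Γ : PlanarNetwork α) (k : ℕ) (ε : Γ.Weighting) : (Γ.trunc k).Weighting :=
  fun e => ε ⟨e.1, Γ.trunc_E_subset k e.2⟩

end PlanarNetwork

/-- The nodes of the triangulation `T_n`: the pairs `(k, i)` with `0 ≤ i ≤ k ≤ n`. The coordinate
`t^k_i` of a tableau `t` is `t ⟨(k, i), _⟩`. -/
abbrev TriNode (n : ℕ) : Type := {p : ℕ × ℕ // p.2 ≤ p.1 ∧ p.1 ≤ n}

/-- The cone `C_2` of real tableaux defined by the interlacing inequalities. -/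
def coneC2 (n : ℕ) : Set (TriNode n → ℝ) :=
  {t | ∀ (k i : ℕ) (_ : 0 < i) (_ : i ≤ k) (_ : k < n),
    t ⟨(k + 1, i - 1), by dsimp only; omega⟩ + t ⟨(k, i), by dsimp only; omega⟩ ≤
      t ⟨(k + 1, i), by dsimp only; omega⟩ + t ⟨(k, i - 1), by dsimp only; omega⟩ ∧
    t ⟨(k + 1, i + 1), by dsimp only; omega⟩ + t ⟨(k, i - 1), by dsimp only; omega⟩ ≤
      t ⟨(k + 1, i), by dsimp only; omega⟩ + t ⟨(k, i), by dsimp only; omega⟩}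

/-- The inclusion of the real tableaux into the tropical ones. -/
def tropTableau {n : ℕ} (t : TriNode n → ℝ) : TriNode n → TropReal := fun p => (t p : TropReal)

/-- The map `LΓ` from weightings to tropical tableaux, `t^k_i = l_i Γ^(k)`. -/
noncomputable def PlanarNetwork.L {α : Type*} (Γ : PlanarNetwork α) (n : ℕ) (ε : Γ.Weighting) :
    TriNode n → TropReal :=
  fun p => (Γ.trunc p.1.1).l p.1.2 (Γ.restrict p.1.1 ε)

/-! ### The triangular network

The vertices on the horizontal line `y = j`, `1 ≤ j ≤ n`, are labelled `(j, m)` from left to right: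
`(j, 0)` is the source and `(j, 2 * j)` is the sink. For `0 < m < 2 * j` and `m` even, a slanted edge
leads from `(j, m)` down to `(j - 1, m - 1)`. So on the lines `1 ≤ j < n` the internal vertices
`(j, 1), …, (j, 2 * j - 1)` are alternately the lower end of a slanted edge from above (`m` odd) and
the upper end of a slanted edge going down (`m` even), while on the top line `j = n` only even `m`
occur. Successive vertices of a line are joined by horizontal edges.
-/

namespace TriangularNetwork

/-- The vertices of the triangular network. -/
def verts (n : ℕ) : Finset (ℕ × ℕ) :=
  (Finset.Icc 1 n ×ˢ Finset.range (2 * n + 1)).filter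
    (fun v => v.2 ≤ 2 * v.1 ∧ (v.1 = n → v.2 % 2 = 0))

/-- The edges of the triangular network: horizontal edges on the lines below the top line,
horizontal edges on the top line, and slanted edges. -/
def edges (n : ℕ) : Finset ((ℕ × ℕ) × (ℕ × ℕ)) :=
  (verts n ×ˢ verts n).filter (fun e =>
    (e.1.1 < n ∧ e.2.1 = e.1.1 ∧ e.2.2 = e.1.2 + 1) ∨
    (e.1.1 = n ∧ e.2.1 = n ∧ e.2.2 = e.1.2 + 2) ∨
    (e.1.1 = e.2.1 + 1 ∧ e.1.2 = e.2.2 + 1 ∧ e.2.2 % 2 = 1))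

/-- The `x`-coordinates of the vertices. -/
def xCoord (n : ℕ) (v : ℕ × ℕ) : ℤ := if v.2 = 0 then -1 else v.2 + 2 * (n - v.1)

/-- The positions of the vertices. -/
def position (n : ℕ) (v : ℕ × ℕ) : ℝ × ℝ := ((xCoord n v : ℝ), (v.1 : ℝ))

theorem mem_verts {n : ℕ} {v : ℕ × ℕ} :
    v ∈ verts n ↔ 1 ≤ v.1 ∧ v.1 ≤ n ∧ v.2 ≤ 2 * v.1 ∧ (v.1 = n → v.2 % 2 = 0) := by
  simp only [verts, Finset.mem_filter, Finset.mem_product, Finset.mem_Icc, Finset.mem_range]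
  constructor
  · rintro ⟨⟨⟨h1, h2⟩, h3⟩, h4, h5⟩
    exact ⟨h1, h2, h4, h5⟩
  · rintro ⟨h1, h2, h4, h5⟩
    exact ⟨⟨⟨h1, h2⟩, by omega⟩, h4, h5⟩

theorem xCoord_lt {n : ℕ} {v w : ℕ × ℕ} (hv : v ∈ verts n) (h : v.1 = w.1) (hlt : v.2 < w.2) :
    xCoord n v < xCoord n w := by
  rw [mem_verts] at hv
  unfold xCoord
  split_ifs <;> omega

/-- The dichotomy horizontal / slanted, in terms of integer coordinates. -/
theorem edge_cases {n : ℕ} {e : (ℕ × ℕ) × (ℕ × ℕ)} (he : e ∈ edges n) :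
    (e.2.1 = e.1.1 ∧ xCoord n e.1 < xCoord n e.2 ∧
      ∀ w ∈ verts n, w.1 = e.1.1 → w.2 ≤ e.1.2 ∨ e.2.2 ≤ w.2) ∨
    (e.1.1 = e.2.1 + 1 ∧ xCoord n e.2 = xCoord n e.1 + 1 ∧
      xCoord n e.1 = e.1.2 + 2 * (n - e.1.1) ∧ e.1.2 % 2 = 0 ∧ e.1.2 = e.2.2 + 1) := by
  simp only [edges, Finset.mem_filter, Finset.mem_product] at he
  obtain ⟨⟨h1, h2⟩, h | h | h⟩ := he
  · exact Or.inl ⟨h.2.1, xCoord_lt h1 h.2.1.symm (by omega), fun w _ _ => by omega⟩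
  · refine Or.inl ⟨by omega, xCoord_lt h1 (by omega) (by omega), fun w hw hw1 => ?_⟩
    rw [mem_verts] at hw h1
    omega
  · refine Or.inr ⟨h.1, ?_, ?_, by omega, h.2.1⟩
    · unfold xCoord
      split_ifs <;> omega
    · unfold xCoord
      split_ifs <;> omega

theorem mem_segment_bounds {u v p : ℝ × ℝ} (hp : p ∈ segment ℝ u v) :
    ∃ s : ℝ, 0 ≤ s ∧ s ≤ 1 ∧ p.1 = u.1 + s * (v.1 - u.1) ∧ p.2 = u.2 + s * (v.2 - u.2) := by
  rw [segment_eq_image'] at hp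
  obtain ⟨s, ⟨hs0, hs1⟩, rfl⟩ := hp
  exact ⟨s, hs0, hs1, by simp, by simp⟩

/-- A point on a horizontal edge. -/
theorem mem_horizontal {n : ℕ} {e : (ℕ × ℕ) × (ℕ × ℕ)} {p : ℝ × ℝ} (h : e.2.1 = e.1.1)
    (hlt : xCoord n e.1 < xCoord n e.2)
    (hp : p ∈ segment ℝ (position n e.1) (position n e.2)) :
    p.2 = e.1.1 ∧ (xCoord n e.1 : ℝ) ≤ p.1 ∧ p.1 ≤ xCoord n e.2 := by
  obtain ⟨s, hs0, hs1, h1, h2⟩ := mem_segment_bounds hp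
  simp only [position] at h1 h2
  have hlt' : (xCoord n e.1 : ℝ) < xCoord n e.2 := by exact_mod_cast hlt
  rw [h] at h2
  refine ⟨by linarith, ?_, ?_⟩ <;> nlinarith

/-- A point on a slanted edge. -/
theorem mem_slanted {n : ℕ} {e : (ℕ × ℕ) × (ℕ × ℕ)} {p : ℝ × ℝ} (h : e.1.1 = e.2.1 + 1)
    (hx : xCoord n e.2 = xCoord n e.1 + 1)
    (hp : p ∈ segment ℝ (position n e.1) (position n e.2)) :
    p.1 + p.2 = xCoord n e.1 + e.1.1 ∧ (e.2.1 : ℝ) ≤ p.2 ∧ p.2 ≤ e.1.1 := by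
  obtain ⟨s, hs0, hs1, h1, h2⟩ := mem_segment_bounds hp
  simp only [position] at h1 h2
  rw [hx] at h1
  rw [h] at h2 ⊢
  push_cast at h1 h2 ⊢
  refine ⟨by linarith, ?_, ?_⟩ <;> nlinarith

theorem edge_ends {n : ℕ} {e : (ℕ × ℕ) × (ℕ × ℕ)} (he : e ∈ edges n) :
    e.1 ∈ verts n ∧ e.2 ∈ verts n :=
  Finset.mem_product.1 (Finset.mem_filter.1 he).1

theorem position_injOn (n : ℕ) : Set.InjOn (position n) (verts n) := by
  intro v hv w hw h
  simp only [position, Prod.mk.injEq, Nat.cast_inj, Int.cast_inj] at h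
  rcases lt_trichotomy v.2 w.2 with hlt | heq | hlt
  · exact absurd h.1 (xCoord_lt hv h.2 hlt).ne
  · exact Prod.ext h.2 heq
  · exact absurd h.1 (xCoord_lt hw h.2.symm hlt).ne'

theorem vertex_on_edge {n : ℕ} {e : (ℕ × ℕ) × (ℕ × ℕ)} (he : e ∈ edges n) {v : ℕ × ℕ}
    (hv : v ∈ verts n) (h : position n v ∈ segment ℝ (position n e.1) (position n e.2)) :
    v = e.1 ∨ v = e.2 := by
  obtain ⟨h1, h2⟩ := edge_ends he
  rcases edge_cases he with ⟨ha, hb, hc⟩ | ⟨ha, hb, -⟩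
  · obtain ⟨hy, hl, hr⟩ := mem_horizontal ha hb h
    simp only [position, Nat.cast_inj, Int.cast_le] at hy hl hr
    rcases hc v hv hy with h' | h'
    · rcases h'.lt_or_eq with h'' | h''
      · exact absurd hl (not_le.2 (xCoord_lt hv hy h''))
      · exact Or.inl (Prod.ext hy h'')
    · rcases h'.lt_or_eq with h'' | h''
      · exact absurd hr (not_le.2 (xCoord_lt h2 (ha.trans hy.symm) h''))
      · exact Or.inr (Prod.ext (hy.trans ha.symm) h''.symm)
  · obtain ⟨hs, hl, hr⟩ := mem_slanted ha hb h
    simp only [position] at hs hl hr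
    norm_cast at hs hl hr
    have hy : v.1 = e.1.1 ∨ v.1 = e.2.1 := by omega
    rcases hy with hy | hy
    · refine Or.inl (position_injOn n hv h1 ?_)
      have : xCoord n v = xCoord n e.1 := by omega
      simp only [position, hy, this]
    · refine Or.inr (position_injOn n hv h2 ?_)
      have : xCoord n v = xCoord n e.2 := by omega
      simp only [position, hy, this]

/-- A point common to a horizontal edge and a slanted edge is a vertex. -/
theorem horizontal_slanted {n : ℕ} {e f : (ℕ × ℕ) × (ℕ × ℕ)} (he : e ∈ edges n) (hf : f ∈ edges n)
    (hae : e.2.1 = e.1.1) (hbe : xCoord n e.1 < xCoord n e.2)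
    (haf : f.1.1 = f.2.1 + 1) (hbf : xCoord n f.2 = xCoord n f.1 + 1) {p : ℝ × ℝ}
    (hp : p ∈ segment ℝ (position n e.1) (position n e.2))
    (hq : p ∈ segment ℝ (position n f.1) (position n f.2)) :
    ∃ v, (v = e.1 ∨ v = e.2) ∧ (v = f.1 ∨ v = f.2) ∧ p = position n v := by
  obtain ⟨hy, -, -⟩ := mem_horizontal hae hbe hp
  obtain ⟨hs, hl, hr⟩ := mem_slanted haf hbf hq
  rw [hy] at hl hr
  norm_cast at hl hr
  have hj : e.1.1 = f.1.1 ∨ e.1.1 = f.2.1 := by omega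
  have key : p = position n f.1 ∨ p = position n f.2 := by
    rcases hj with hj | hj
    · refine Or.inl (Prod.ext ?_ ?_)
      · simp only [position]; rw [hy, hj] at hs; linarith
      · simp only [position]; rw [hy, hj]
    · refine Or.inr (Prod.ext ?_ ?_)
      · simp only [position]; rw [hy, hj, haf] at hs; rw [hbf]; push_cast at hs ⊢; linarith
      · simp only [position]; rw [hy, hj]
  rcases key with rfl | rfl
  · exact ⟨f.1, vertex_on_edge he (edge_ends hf).1 hp, Or.inl rfl, rfl⟩
  · exact ⟨f.2, vertex_on_edge he (edge_ends hf).2 hp, Or.inr rfl, rfl⟩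

/-- Two horizontal edges on the same line, the second to the right of the first. -/
theorem horizontal_horizontal {n : ℕ} {e f : (ℕ × ℕ) × (ℕ × ℕ)} (he : e ∈ edges n)
    (hae : e.2.1 = e.1.1) (hbe : xCoord n e.1 < xCoord n e.2)
    (haf : f.2.1 = f.1.1) (hbf : xCoord n f.1 < xCoord n f.2) (hle : e.2.2 ≤ f.1.2) {p : ℝ × ℝ}
    (hp : p ∈ segment ℝ (position n e.1) (position n e.2))
    (hq : p ∈ segment ℝ (position n f.1) (position n f.2)) :
    e.2 = f.1 ∧ p = position n e.2 := by
  obtain ⟨hy, hl, hr⟩ := mem_horizontal hae hbe hp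
  obtain ⟨hy', hl', hr'⟩ := mem_horizontal haf hbf hq
  have hj : e.1.1 = f.1.1 := by rw [hy] at hy'; exact_mod_cast hy'
  have hx : xCoord n f.1 ≤ xCoord n e.2 := by exact_mod_cast hl'.trans hr
  have hm : e.2.2 = f.1.2 := by
    rcases hle.lt_or_eq with h | h
    · exact absurd hx (not_le.2 (xCoord_lt (edge_ends he).2 (hae.trans hj) h))
    · exact h
  have hef : e.2 = f.1 := Prod.ext (hae.trans hj) hm
  refine ⟨hef, Prod.ext ?_ ?_⟩
  · simp only [position]
    rw [← hef] at hl'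
    linarith
  · simp only [position]
    rw [hy, hae]

theorem edges_noncrossing {n : ℕ} {e f : (ℕ × ℕ) × (ℕ × ℕ)} (he : e ∈ edges n) (hf : f ∈ edges n)
    (hne : e ≠ f) {p : ℝ × ℝ} (hp : p ∈ segment ℝ (position n e.1) (position n e.2))
    (hq : p ∈ segment ℝ (position n f.1) (position n f.2)) :
    ∃ v, (v = e.1 ∨ v = e.2) ∧ (v = f.1 ∨ v = f.2) ∧ p = position n v := by
  rcases edge_cases he with ⟨hae, hbe, hce⟩ | ⟨hae, hbe, hce, hde, hee⟩
  · rcases edge_cases hf with ⟨haf, hbf, hcf⟩ | ⟨haf, hbf, -⟩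
    · have hy := (mem_horizontal hae hbe hp).1
      have hy' := (mem_horizontal haf hbf hq).1
      have hj : e.1.1 = f.1.1 := by rw [hy] at hy'; exact_mod_cast hy'
      by_cases h1 : e.2.2 ≤ f.1.2
      · obtain ⟨h2, h3⟩ := horizontal_horizontal he hae hbe haf hbf h1 hp hq
        exact ⟨e.2, Or.inr rfl, Or.inl h2, h3⟩
      by_cases h2 : f.2.2 ≤ e.1.2
      · obtain ⟨h3, h4⟩ := horizontal_horizontal hf haf hbf hae hbe h2 hq hp
        exact ⟨f.2, Or.inl h3, Or.inr rfl, h4⟩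
      exfalso
      have k1 := hce f.1 (edge_ends hf).1 hj.symm
      have k2 := hce f.2 (edge_ends hf).2 (haf.trans hj.symm)
      have k3 := hcf e.1 (edge_ends he).1 hj
      have k4 := hcf e.2 (edge_ends he).2 (hae.trans hj)
      exact hne (Prod.ext (Prod.ext hj (by omega))
        (Prod.ext (hae.trans (hj.trans haf.symm)) (by omega)))
    · exact horizontal_slanted he hf hae hbe haf hbf hp hq
  · rcases edge_cases hf with ⟨haf, hbf, -⟩ | ⟨haf, hbf, hcf, hdf, hef⟩
    · obtain ⟨v, h1, h2, h3⟩ := horizontal_slanted hf he haf hbf hae hbe hq hp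
      exact ⟨v, h2, h1, h3⟩
    · exfalso
      obtain ⟨hs, hl, hr⟩ := mem_slanted hae hbe hp
      obtain ⟨hs', hl', hr'⟩ := mem_slanted haf hbf hq
      have hsum : xCoord n e.1 + e.1.1 = xCoord n f.1 + f.1.1 := by
        rw [hs] at hs'
        exact_mod_cast hs'
      have h1 : e.2.1 ≤ f.1.1 := by exact_mod_cast hl.trans hr'
      have h2 : f.2.1 ≤ e.1.1 := by exact_mod_cast hl'.trans hr
      have h3 : e.1.1 = f.1.1 := by omega
      have h4 : e.1.2 = f.1.2 := by omega
      exact hne (Prod.ext (Prod.ext h3 h4) (Prod.ext (by omega) (by omega)))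

theorem xCoord_bounds {n : ℕ} {v : ℕ × ℕ} (hv : v ∈ verts n) :
    (-1 ≤ xCoord n v ∧ xCoord n v ≤ 2 * n) ∧ (xCoord n v = -1 ↔ v.2 = 0) ∧
      (xCoord n v = 2 * n ↔ v.2 = 2 * v.1) := by
  rw [mem_verts] at hv
  unfold xCoord
  split_ifs <;> omega

/-- The triangular network of rank `n`. -/
noncomputable def network (n : ℕ) : PlanarNetwork (ℕ × ℕ) where
  V := verts n
  E := edges n
  pos := position n
  a := -1
  b := 2 * n
  a_lt_b := by
    have : (0 : ℝ) ≤ n := Nat.cast_nonneg n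
    linarith
  ends_mem := fun _ he => edge_ends he
  pos_injOn := position_injOn n
  strip := fun v hv => by
    simp only [position]
    exact_mod_cast (xCoord_bounds hv).1
  left_to_right := fun e he => by
    simp only [position, Int.cast_lt]
    rcases edge_cases he with h | h
    · exact h.2.1
    · omega
  vertex_on_edge := fun _ he _ hv h => vertex_on_edge he hv h
  edges_noncrossing := fun _ he _ hf hne _ hp hq => edges_noncrossing he hf hne hp hq

theorem network_isSource {n : ℕ} {v : ℕ × ℕ} :
    (network n).IsSource v ↔ v ∈ verts n ∧ v.2 = 0 := by
  refine and_congr_right fun hv => ?_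
  rw [← (xCoord_bounds hv).2.1]
  simp only [network, position]
  norm_cast

theorem network_isSink {n : ℕ} {v : ℕ × ℕ} :
    (network n).IsSink v ↔ v ∈ verts n ∧ v.2 = 2 * v.1 := by
  refine and_congr_right fun hv => ?_
  rw [← (xCoord_bounds hv).2.2]
  simp only [network, position]
  norm_cast

theorem network_hasRank (n : ℕ) : (network n).HasRank n := by
  constructor
  · ext y
    constructor
    · rintro ⟨v, hv, rfl⟩
      have h := mem_verts.1 (network_isSource.1 hv).1
      exact ⟨v.1, ⟨h.1, h.2.1⟩, rfl⟩
    · rintro ⟨j, hj, rfl⟩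
      exact ⟨(j, 0), network_isSource.2 ⟨mem_verts.2 ⟨hj.1, hj.2, by simp, by simp⟩, rfl⟩, rfl⟩
  · ext y
    constructor
    · rintro ⟨v, hv, rfl⟩
      have h := mem_verts.1 (network_isSink.1 hv).1
      exact ⟨v.1, ⟨h.1, h.2.1⟩, rfl⟩
    · rintro ⟨j, hj, rfl⟩
      exact ⟨(j, 2 * j), network_isSink.2 ⟨mem_verts.2 ⟨hj.1, hj.2, by simp, by simp⟩, rfl⟩, rfl⟩

end TriangularNetwork

/-! Real weights come first. Recording on each face the number of paths above it turns an `i`-path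
of `Γ^(k)` into an integer function `N` that is `0` above line `k`, equals `i` below line `1`, and
jumps by `0` or `1` across every edge (`usage`). Conversely every such `N` (`IsHeight`) comes from
an `i`-path, because jumps are conserved at internal vertices. The weight is linear in `N`, so `l_i
Γ^(k)` is the maximum of a linear functional over height functions.

Necessity: if `M` and `N` are optimal for rows `k + 1` and `k`, then `(M + N) / 2` rounded up and
rounded down are again height functions for these rows, and they add up to `M + N` (`exchange`).
Both inequalities of `C_2` are instances. Density of the real weightings and continuity of `L` carry
this over to the closure.

Sufficiency: for a real tableau in the cone with zero first column, the differences `λ^k_m =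
t^k_{m+1} - t^k_m` form a Gelfand–Tsetlin pattern. The edge leaving `(r, 2m)` to the right gets
weight `λ^r_m - λ^{r-1}_{m-1}` (just `λ^r_0` for `m = 0`), all other edges get `0`. The staircase
`i`-path telescopes to `t^k_i` (`heightWeight_staircase`). No `i`-path does better, by weak linear
programming duality: `t^k_i` is the minimum over `C` of `i C + ∑_m max(λ^k_m - C, 0)`, and every `C`
gives an upper bound (`IsHeight.partial_bound`).

For limit tableaux, these weights are bounded above in terms of the tableau and `[-∞, M]` is
compact, so the realizing weightings accumulate at a weighting that realizes the limit. -/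

open Filter Topology

/-! ### Topology of the tropical numbers -/

theorem WithBot.tendsto_add_nhds_bot {x y : TropReal} (h : x = ⊥) :
    Tendsto (fun p : TropReal × TropReal => p.1 + p.2) (𝓝 (x, y)) (𝓝 (x + y)) := by
  subst h
  rw [WithBot.bot_add, WithBot.tendsto_nhds_bot_iff]
  intro i
  -- Near `y` the second summand stays below `c`, so a first summand below `i - c` keeps the sum
  -- below `i`.
  obtain ⟨c, hc⟩ : ∃ c : ℝ, y < c := by
    induction y using WithBot.recBotCoe with
    | bot => exact ⟨0, WithBot.bot_lt_coe _⟩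
    | coe r => exact ⟨r + 1, by exact_mod_cast lt_add_one r⟩
  have h1 : ∀ᶠ p : TropReal × TropReal in 𝓝 (⊥, y), p.1 < ((i - c : ℝ) : TropReal) :=
    continuous_fst.continuousAt.eventually (Iio_mem_nhds (WithBot.bot_lt_coe _))
  have h2 : ∀ᶠ p : TropReal × TropReal in 𝓝 (⊥, y), p.2 < (c : TropReal) :=
    continuous_snd.continuousAt.eventually (Iio_mem_nhds hc)
  filter_upwards [h1, h2] with p hp1 hp2
  obtain ⟨p, q⟩ := p
  induction p using WithBot.recBotCoe with
  | bot => simp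
  | coe p =>
    induction q using WithBot.recBotCoe with
    | bot => simp
    | coe q =>
      simp only [WithBot.coe_lt_coe, ← WithBot.coe_add] at *
      linarith

instance TropReal.instContinuousAdd : ContinuousAdd TropReal := by
  refine ⟨continuous_iff_continuousAt.2 ?_⟩
  rintro ⟨x, y⟩
  induction x using WithBot.recBotCoe with
  | bot => exact WithBot.tendsto_add_nhds_bot rfl
  | coe a =>
    induction y using WithBot.recBotCoe with
    | bot =>
      have h := (WithBot.tendsto_add_nhds_bot (x := ⊥) (y := (a : TropReal)) rfl).comp
        (continuous_swap.tendsto ((a : TropReal), (⊥ : TropReal)))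
      simpa [ContinuousAt, Function.comp_def, add_comm] using h
    | coe b =>
      rw [ContinuousAt, ← Prod.map_apply,
        ← (WithBot.isOpenEmbedding_coe.prodMap WithBot.isOpenEmbedding_coe).map_nhds_eq,
        tendsto_map'_iff]
      have h : Continuous fun p : ℝ × ℝ => ((p.1 + p.2 : ℝ) : TropReal) :=
        WithBot.continuous_coe.comp continuous_add
      simpa [Function.comp_def] using h.tendsto (a, b)

theorem TropReal.denseRange_coe : DenseRange ((↑) : ℝ → TropReal) := by
  intro x
  induction x using WithBot.recBotCoe with
  | coe r => exact subset_closure ⟨r, rfl⟩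
  | bot =>
    have h : Tendsto ((↑) : ℝ → TropReal) atBot (𝓝 ⊥) := by
      rw [WithBot.tendsto_nhds_bot_iff]
      intro i
      filter_upwards [eventually_lt_atBot i] with r hr
      exact WithBot.coe_lt_coe.2 hr
    exact mem_closure_of_tendsto h (Eventually.of_forall fun r => ⟨r, rfl⟩)

/-! ### Continuity of `L` and density of the real weightings -/

namespace PlanarNetwork

variable {α : Type*}

theorem continuous_weight (Γ : PlanarNetwork α) (S : Finset α × Finset (α × α)) :
    Continuous fun ε : Γ.Weighting => Γ.weight ε S :=
  continuous_finsetSum _ fun _ _ => continuous_apply _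

theorem continuous_l (Γ : PlanarNetwork α) (i : ℕ) : Continuous (Γ.l i) := by
  unfold l
  split_ifs
  · exact continuous_const
  · exact Continuous.finset_sup_apply fun S _ => Γ.continuous_weight S

theorem continuous_restrict (Γ : PlanarNetwork α) (k : ℕ) : Continuous (Γ.restrict k) :=
  continuous_pi fun _ => continuous_apply _

theorem continuous_L (Γ : PlanarNetwork α) (n : ℕ) : Continuous (Γ.L n) :=
  continuous_pi fun p => ((Γ.trunc p.1.1).continuous_l p.1.2).comp (Γ.continuous_restrict p.1.1)

/-- The tropical weighting given by real edge weights. -/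
def realWeighting (Γ : PlanarNetwork α) (w : α × α → ℝ) : Γ.Weighting := fun e => (w e.1 : TropReal)

theorem denseRange_realWeighting (Γ : PlanarNetwork α) : DenseRange Γ.realWeighting := by
  have h := DenseRange.piMap (fun _ : {e : α × α // e ∈ Γ.E} => TropReal.denseRange_coe)
  refine h.mono ?_
  rintro _ ⟨w, rfl⟩
  classical
  refine ⟨fun e => if h : e ∈ Γ.E then w ⟨e, h⟩ else 0, ?_⟩
  ext1 e
  simp [realWeighting]

theorem weight_realWeighting (Γ : PlanarNetwork α) (w : α × α → ℝ) {S : Finset α × Finset (α × α)}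
    (hS : S.2 ⊆ Γ.E) : Γ.weight (Γ.realWeighting w) S = ((∑ e ∈ S.2, w e : ℝ) : TropReal) := by
  classical
  rw [weight, WithBot.coe_sum, ← Finset.sum_subtype_of_mem (p := (· ∈ Γ.E)) (s := S.2)
    (fun e => (w e : TropReal)) (fun e he => hS he)]
  refine Finset.sum_congr ?_ fun _ _ => rfl
  ext e
  simp

/-- By density and continuity, the image of `L` lies in the closure of any set that contains the images
of all real weightings. -/
theorem range_L_subset_closure (Γ : PlanarNetwork α) (n : ℕ) (A : Set (TriNode n → TropReal))
    (h : ∀ w, Γ.L n (Γ.realWeighting w) ∈ A) : Set.range (Γ.L n) ⊆ closure A := by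
  rintro _ ⟨ε, rfl⟩
  have hε : ε ∈ closure (Set.range Γ.realWeighting) := Γ.denseRange_realWeighting ε
  refine closure_mono ?_ (image_closure_subset_closure_image (Γ.continuous_L n) ⟨ε, hε, rfl⟩)
  rintro _ ⟨_, ⟨w, rfl⟩, rfl⟩
  exact h w

end PlanarNetwork

/-! ### Local structure of the triangular network -/

namespace TriangularNetwork

/-- The horizontal edge of line `r` that starts at `(r, 2 * m)`. -/
def outEdge (n r m : ℕ) : (ℕ × ℕ) × (ℕ × ℕ) :=
  if r < n then ((r, 2 * m), (r, 2 * m + 1)) else ((r, 2 * m), (r, 2 * m + 2))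

/-- The horizontal edge of line `r` that joins the end of a slanted edge from above to the start of
the next slanted edge. -/
def midEdge (r m : ℕ) : (ℕ × ℕ) × (ℕ × ℕ) := ((r, 2 * m + 1), (r, 2 * m + 2))

/-- The slanted edges from line `r + 1` to line `r`. -/
def slantEdge (r m : ℕ) : (ℕ × ℕ) × (ℕ × ℕ) := ((r + 1, 2 * m + 2), (r, 2 * m + 1))

theorem outEdge_mem {n r m : ℕ} : outEdge n r m ∈ edges n ↔ m < r ∧ r ≤ n := by
  unfold outEdge
  split_ifs with h <;> simp [edges, mem_verts] <;> omega

theorem midEdge_mem {n r m : ℕ} : midEdge r m ∈ edges n ↔ m < r ∧ r < n := by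
  simp [midEdge, edges, mem_verts]
  omega

theorem slantEdge_mem {n r m : ℕ} : slantEdge r m ∈ edges n ↔ m < r ∧ r < n := by
  simp [slantEdge, edges, mem_verts]
  omega

theorem mem_edges_iff {n : ℕ} {e : (ℕ × ℕ) × (ℕ × ℕ)} :
    e ∈ edges n ↔ (∃ r m, m < r ∧ r ≤ n ∧ e = outEdge n r m) ∨
      (∃ r m, m < r ∧ r < n ∧ e = midEdge r m) ∨ ∃ r m, m < r ∧ r < n ∧ e = slantEdge r m := by
  constructor
  · intro he
    obtain ⟨⟨a, b⟩, c, d⟩ := e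
    simp only [edges, mem_verts, Finset.mem_filter, Finset.mem_product] at he
    by_cases h1 : c = a
    · rcases Nat.even_or_odd' b with ⟨m, rfl | rfl⟩
      · refine Or.inl ⟨a, m, by omega, by omega, ?_⟩
        unfold outEdge
        split_ifs <;> simp only [Prod.mk.injEq, true_and] <;> omega
      · refine Or.inr (Or.inl ⟨a, m, by omega, by omega, ?_⟩)
        simp only [midEdge, Prod.mk.injEq, true_and]
        omega
    · refine Or.inr (Or.inr ⟨c, d / 2, by omega, by omega, ?_⟩)
      simp only [slantEdge, Prod.mk.injEq, true_and]
      omega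
  · rintro (⟨r, m, h1, h2, rfl⟩ | ⟨r, m, h1, h2, rfl⟩ | ⟨r, m, h1, h2, rfl⟩)
    · exact outEdge_mem.2 ⟨h1, h2⟩
    · exact midEdge_mem.2 ⟨h1, h2⟩
    · exact slantEdge_mem.2 ⟨h1, h2⟩

/-- The edges ending in `v`. -/
def inEdges (n : ℕ) (v : ℕ × ℕ) : Finset ((ℕ × ℕ) × (ℕ × ℕ)) := (edges n).filter (fun e => e.2 = v)

/-- The edges starting in `v`. -/
def outEdges (n : ℕ) (v : ℕ × ℕ) : Finset ((ℕ × ℕ) × (ℕ × ℕ)) := (edges n).filter (fun e => e.1 = v)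

theorem inEdges_source {n r : ℕ} : inEdges n (r, 0) = ∅ := by
  ext ⟨⟨a, b⟩, c, d⟩
  simp [inEdges, edges, mem_verts]
  omega

theorem inEdges_odd {n r m : ℕ} (hm : m < r) (hr : r < n) :
    inEdges n (r, 2 * m + 1) = {outEdge n r m, slantEdge r m} := by
  ext ⟨⟨a, b⟩, c, d⟩
  simp [inEdges, edges, mem_verts, outEdge, slantEdge, hr]
  omega

theorem inEdges_even {n r m : ℕ} (hm : m < r) (hr : r < n) :
    inEdges n (r, 2 * m + 2) = {midEdge r m} := by
  ext ⟨⟨a, b⟩, c, d⟩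
  simp [inEdges, edges, mem_verts, midEdge]
  omega

theorem inEdges_top {n m : ℕ} (hm : m < n) : inEdges n (n, 2 * m + 2) = {outEdge n n m} := by
  ext ⟨⟨a, b⟩, c, d⟩
  simp [inEdges, edges, mem_verts, outEdge]
  omega

theorem outEdges_source {n r : ℕ} (h0 : 0 < r) (hr : r ≤ n) :
    outEdges n (r, 0) = {outEdge n r 0} := by
  ext ⟨⟨a, b⟩, c, d⟩
  unfold outEdge
  split_ifs <;> simp [outEdges, edges, mem_verts] <;> omega

theorem outEdges_odd {n r m : ℕ} (hm : m < r) (hr : r < n) :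
    outEdges n (r, 2 * m + 1) = {midEdge r m} := by
  ext ⟨⟨a, b⟩, c, d⟩
  simp [outEdges, edges, mem_verts, midEdge]
  omega

theorem outEdges_even {n r m : ℕ} (hm : m < r) (hr : r < n) :
    outEdges n (r + 1, 2 * m + 2) = {outEdge n (r + 1) (m + 1), slantEdge r m} := by
  ext ⟨⟨a, b⟩, c, d⟩
  unfold outEdge
  split_ifs <;> simp [outEdges, edges, mem_verts, slantEdge] <;> omega

theorem outEdges_sink {n r : ℕ} : outEdges n (r, 2 * r) = ∅ := by
  ext ⟨⟨a, b⟩, c, d⟩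
  simp [outEdges, edges, mem_verts]
  omega

theorem outEdge_ne_slantEdge {n r s m p : ℕ} : outEdge n r m ≠ slantEdge s p := by
  unfold outEdge slantEdge
  split_ifs <;> simp <;> omega

/-- The vertices are the sources, the odd vertices below the top line, and the even vertices. -/
theorem vert_cases {n : ℕ} {v : ℕ × ℕ} (hv : v ∈ verts n) :
    (∃ r, 0 < r ∧ r ≤ n ∧ v = (r, 0)) ∨ (∃ r, 0 < r ∧ r ≤ n ∧ v = (r, 2 * r)) ∨
      (∃ r m, m < r ∧ r < n ∧ v = (r, 2 * m + 1)) ∨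
        ∃ r m, m < r ∧ r < n ∧ v = (r + 1, 2 * m + 2) := by
  obtain ⟨a, b⟩ := v
  rw [mem_verts] at hv
  dsimp only at hv
  rcases Nat.even_or_odd' b with ⟨m, rfl | rfl⟩
  · by_cases h0 : m = 0
    · exact Or.inl ⟨a, by omega, by omega, by simp [h0]⟩
    by_cases h1 : m = a
    · exact Or.inr (Or.inl ⟨a, by omega, by omega, by simp [h1]⟩)
    · refine Or.inr (Or.inr (Or.inr ⟨a - 1, m - 1, by omega, by omega, ?_⟩))
      simp only [Prod.mk.injEq]
      omega
  · exact Or.inr (Or.inr (Or.inl ⟨a, m, by omega, by omega, rfl⟩))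

/-! ### Degrees, truncations and multipaths -/

open PlanarNetwork

theorem inDegree_eq_sum {n : ℕ} {F : Finset ((ℕ × ℕ) × (ℕ × ℕ))} (hF : F ⊆ edges n) (v : ℕ × ℕ) :
    (inDegree F v : ℤ) = ∑ e ∈ inEdges n v, if e ∈ F then 1 else 0 := by
  rw [Finset.sum_boole, inDegree]
  congr 2
  ext e
  simp only [Finset.mem_filter, inEdges]
  have := @hF e
  tauto

theorem outDegree_eq_sum {n : ℕ} {F : Finset ((ℕ × ℕ) × (ℕ × ℕ))} (hF : F ⊆ edges n) (v : ℕ × ℕ) :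
    (outDegree F v : ℤ) = ∑ e ∈ outEdges n v, if e ∈ F then 1 else 0 := by
  rw [Finset.sum_boole, outDegree]
  congr 2
  ext e
  simp only [Finset.mem_filter, outEdges]
  have := @hF e
  tauto

theorem keptBy_iff {n k : ℕ} {v : ℕ × ℕ} (hv : v ∈ verts n) :
    (network n).KeptBy k v ↔ (v.2 = 0 ∨ v.2 = 2 * v.1 → v.1 ≤ k) := by
  rw [KeptBy, network_isSource, network_isSink]
  simp only [network, position, Nat.cast_lt, not_and, not_lt, hv, true_and]

theorem trunc_isSource {n k : ℕ} {v : ℕ × ℕ} :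
    ((network n).trunc k).IsSource v ↔ v ∈ verts n ∧ v.2 = 0 ∧ v.1 ≤ k := by
  have h : ((network n).trunc k).IsSource v ↔
      (network n).IsSource v ∧ (network n).KeptBy k v := by
    simp only [IsSource, trunc, Finset.mem_filter]
    tauto
  rw [h, network_isSource, and_assoc]
  refine and_congr_right fun hv => ?_
  rw [keptBy_iff hv]
  tauto

theorem trunc_isSink {n k : ℕ} {v : ℕ × ℕ} :
    ((network n).trunc k).IsSink v ↔ v ∈ verts n ∧ v.2 = 2 * v.1 ∧ v.1 ≤ k := by
  have h : ((network n).trunc k).IsSink v ↔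
      (network n).IsSink v ∧ (network n).KeptBy k v := by
    simp only [IsSink, trunc, Finset.mem_filter]
    tauto
  rw [h, network_isSink, and_assoc]
  refine and_congr_right fun hv => ?_
  rw [keptBy_iff hv]
  tauto

theorem mem_trunc_verts {n k : ℕ} {v : ℕ × ℕ} :
    v ∈ ((network n).trunc k).V ↔ v ∈ verts n ∧ (v.2 = 0 ∨ v.2 = 2 * v.1 → v.1 ≤ k) := by
  simp only [trunc, Finset.mem_filter]
  exact and_congr_right fun hv => keptBy_iff hv

theorem mem_trunc_edges {n k : ℕ} {e : (ℕ × ℕ) × (ℕ × ℕ)} :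
    e ∈ ((network n).trunc k).E ↔ e ∈ edges n ∧ (e.1.2 = 0 ∨ e.1.2 = 2 * e.1.1 → e.1.1 ≤ k) ∧
      (e.2.2 = 0 ∨ e.2.2 = 2 * e.2.1 → e.2.1 ≤ k) := by
  simp only [trunc, Finset.mem_filter]
  exact and_congr_right fun he =>
    and_congr (keptBy_iff (edge_ends he).1) (keptBy_iff (edge_ends he).2)

theorem mem_paths {n k i : ℕ} {S : Finset (ℕ × ℕ) × Finset ((ℕ × ℕ) × (ℕ × ℕ))} :
    S ∈ ((network n).trunc k).paths i ↔ ((network n).trunc k).IsMultipath S ∧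
      (S.1.filter (fun v => v.2 = 0)).card = i := by
  have h : ∀ T : ((network n).trunc k).IsMultipath S, (S.1.filter (fun v => v.2 = 0)) =
      (by classical exact S.1.filter ((network n).trunc k).IsSource) := by
    intro T
    ext v
    simp only [Finset.mem_filter]
    refine and_congr_right fun hv => ?_
    have h1 := mem_trunc_verts.1 (T.1.1 hv)
    rw [trunc_isSource]
    tauto
  simp only [paths, Finset.mem_filter, Finset.mem_product, Finset.mem_powerset]
  constructor
  · rintro ⟨-, h1, h2⟩
    refine ⟨h1, ?_⟩
    rw [h h1, ← h2]
  · rintro ⟨h1, h2⟩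
    refine ⟨⟨h1.1.1, h1.1.2.1⟩, h1, ?_⟩
    rw [← h2, h h1]

theorem card_sources {n : ℕ} {A : Finset (ℕ × ℕ)} (hA : A ⊆ verts n) :
    ((A.filter (fun v => v.2 = 0)).card : ℤ) =
      ∑ r ∈ Finset.range n, if (r + 1, 0) ∈ A then 1 else 0 := by
  rw [Finset.sum_boole]
  congr 1
  symm
  refine Finset.card_bij (fun r _ => (r + 1, 0)) ?_ ?_ ?_
  · intro r hr
    simpa using (Finset.mem_filter.1 hr).2
  · intro r _ s _ h
    simpa using h
  · rintro ⟨a, b⟩ hv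
    rw [Finset.mem_filter] at hv
    obtain ⟨hv, rfl⟩ := hv
    have h1 := mem_verts.1 (hA hv)
    refine ⟨a - 1, ?_, ?_⟩
    · simp only [Finset.mem_filter, Finset.mem_range]
      dsimp only at h1
      have h2 : a - 1 + 1 = a := by omega
      exact ⟨by omega, by rwa [h2]⟩
    · simp only [Prod.mk.injEq, and_true]
      dsimp only at h1
      omega

/-! ### Multipaths as height functions on faces -/

/-- The difference of a function on the faces of the triangular network across an edge, where
`N j m` is the value on the face between the lines `j` and `j + 1` that lies between their `m`-th
and `(m + 1)`-st slanted edges. -/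
def usage (N : ℕ → ℕ → ℤ) (e : (ℕ × ℕ) × (ℕ × ℕ)) : ℤ :=
  if e.2.1 = e.1.1 then N (e.1.1 - 1) (e.1.2 / 2) - N e.1.1 ((e.1.2 + 1) / 2)
  else N (e.1.1 - 1) (e.1.2 / 2 - 1) - N (e.1.1 - 1) (e.1.2 / 2)

theorem usage_outEdge (N : ℕ → ℕ → ℤ) (n r m : ℕ) :
    usage N (outEdge n r m) = N (r - 1) m - N r m := by
  have h1 : (2 * m + 1) / 2 = m := by omega
  have h2 : 2 * m / 2 = m := by omega
  unfold outEdge usage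
  split_ifs <;> simp [h1, h2] at *

theorem usage_midEdge (N : ℕ → ℕ → ℤ) (r m : ℕ) :
    usage N (midEdge r m) = N (r - 1) m - N r (m + 1) := by
  have h1 : (2 * m + 1 + 1) / 2 = m + 1 := by omega
  have h2 : (2 * m + 1) / 2 = m := by omega
  simp [usage, midEdge, h1, h2]

theorem usage_slantEdge (N : ℕ → ℕ → ℤ) (r m : ℕ) :
    usage N (slantEdge r m) = N r m - N r (m + 1) := by
  have h1 : (2 * m + 2) / 2 = m + 1 := by omega
  simp [usage, slantEdge, h1]

/-- The functions on faces that count the paths above each face, for an `i`-path using only the lines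
up to `k`. -/
structure IsHeight (n k i : ℕ) (N : ℕ → ℕ → ℤ) : Prop where
  eq_zero : ∀ j m, k ≤ j → m ≤ j → N j m = 0
  base : N 0 0 = i
  usage_mem : ∀ e ∈ edges n, usage N e = 0 ∨ usage N e = 1

/-- A flow is conserved at the internal vertices if it is given by differences across edges. -/
theorem sum_usage {n : ℕ} {N : ℕ → ℕ → ℤ} (hN : ∀ m ≤ n, N n m = 0) {v : ℕ × ℕ} (hv : v ∈ verts n)
    (h0 : v.2 ≠ 0) (h1 : v.2 ≠ 2 * v.1) :
    ∑ e ∈ inEdges n v, usage N e = ∑ e ∈ outEdges n v, usage N e := by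
  rcases vert_cases hv with ⟨r, -, -, rfl⟩ | ⟨r, -, -, rfl⟩ | ⟨r, m, hm, hr, rfl⟩ | ⟨r, m, hm, hr, rfl⟩
  · exact absurd rfl h0
  · exact absurd rfl h1
  · rw [inEdges_odd hm hr, outEdges_odd hm hr, Finset.sum_pair outEdge_ne_slantEdge,
      Finset.sum_singleton, usage_outEdge, usage_slantEdge, usage_midEdge]
    ring
  · rw [outEdges_even hm hr, Finset.sum_pair outEdge_ne_slantEdge, usage_outEdge, usage_slantEdge]
    rcases Nat.lt_or_ge (r + 1) n with h | h
    · rw [inEdges_even (by omega) h, Finset.sum_singleton, usage_midEdge]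
      simp
    · obtain rfl : n = r + 1 := by omega
      rw [inEdges_top (by omega), Finset.sum_singleton, usage_outEdge]
      simp [hN m (by omega), hN (m + 1) (by omega)]

/-- At each vertex one of the two sides has at most one edge. -/
theorem card_inEdges_or_outEdges {n : ℕ} {v : ℕ × ℕ} (hv : v ∈ verts n) :
    (inEdges n v).card ≤ 1 ∨ (outEdges n v).card ≤ 1 := by
  rcases vert_cases hv with ⟨r, -, -, rfl⟩ | ⟨r, -, -, rfl⟩ | ⟨r, m, hm, hr, rfl⟩ | ⟨r, m, hm, hr, rfl⟩
  · simp [inEdges_source]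
  · simp [outEdges_sink]
  · simp [outEdges_odd hm hr]
  · rcases Nat.lt_or_ge (r + 1) n with h | h
    · simp [inEdges_even (by omega : m < r + 1) h]
    · obtain rfl : n = r + 1 := by omega
      simp [inEdges_top (by omega : m < r + 1)]

theorem card_inEdges_sink {n r : ℕ} (h0 : 0 < r) (hr : r ≤ n) : (inEdges n (r, 2 * r)).card ≤ 1 := by
  obtain ⟨m, rfl⟩ : ∃ m, r = m + 1 := ⟨r - 1, by omega⟩
  rcases hr.lt_or_eq with h | h
  · simp [mul_add, inEdges_even (by omega : m < m + 1) h]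
  · subst h
    simp [mul_add, inEdges_top (by omega : m < m + 1)]

theorem sum_le_one_of_card_le_one {ι : Type*} {s : Finset ι} (hs : s.card ≤ 1) {x : ι → ℤ}
    (hx : ∀ e ∈ s, x e ≤ 1) : ∑ e ∈ s, x e ≤ 1 := by
  have h1 := Finset.sum_le_card_nsmul s x 1 hx
  have h2 : ((s.card : ℕ) : ℤ) ≤ 1 := by exact_mod_cast hs
  exact h1.trans (by simpa using h2)

/-- The subnetwork of edges of usage one. -/
def subnetwork (n : ℕ) (N : ℕ → ℕ → ℤ) : Finset (ℕ × ℕ) × Finset ((ℕ × ℕ) × (ℕ × ℕ)) :=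
  (((edges n).filter (fun e => usage N e = 1)).image Prod.fst ∪
    ((edges n).filter (fun e => usage N e = 1)).image Prod.snd,
    (edges n).filter (fun e => usage N e = 1))

section Height

variable {n k i : ℕ} {N : ℕ → ℕ → ℤ} (hN : IsHeight n k i N)
include hN

theorem IsHeight.indicator {e : (ℕ × ℕ) × (ℕ × ℕ)} (he : e ∈ edges n) :
    (if e ∈ (subnetwork n N).2 then (1 : ℤ) else 0) = usage N e := by
  simp only [subnetwork, Finset.mem_filter, he, true_and]
  rcases hN.usage_mem e he with h | h <;> simp [h]

theorem IsHeight.inDegree_eq (v : ℕ × ℕ) :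
    (inDegree (subnetwork n N).2 v : ℤ) = ∑ e ∈ inEdges n v, usage N e := by
  rw [inDegree_eq_sum (F := (subnetwork n N).2) (Finset.filter_subset _ _)]
  exact Finset.sum_congr rfl fun e he => hN.indicator (Finset.mem_filter.1 he).1

theorem IsHeight.outDegree_eq (v : ℕ × ℕ) :
    (outDegree (subnetwork n N).2 v : ℤ) = ∑ e ∈ outEdges n v, usage N e := by
  rw [outDegree_eq_sum (F := (subnetwork n N).2) (Finset.filter_subset _ _)]
  exact Finset.sum_congr rfl fun e he => hN.indicator (Finset.mem_filter.1 he).1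

theorem IsHeight.usage_nonneg {e : (ℕ × ℕ) × (ℕ × ℕ)} (he : e ∈ edges n) : 0 ≤ usage N e := by
  rcases hN.usage_mem e he with h | h <;> omega

theorem IsHeight.usage_le_one {e : (ℕ × ℕ) × (ℕ × ℕ)} (he : e ∈ edges n) : usage N e ≤ 1 := by
  rcases hN.usage_mem e he with h | h <;> omega

theorem IsHeight.row_le {e : (ℕ × ℕ) × (ℕ × ℕ)} (he : e ∈ (subnetwork n N).2) :
    e.1.1 ≤ k ∧ e.2.1 ≤ k := by
  obtain ⟨he, h1⟩ := Finset.mem_filter.1 he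
  by_contra hk
  have h : usage N e = 0 := by
    rcases mem_edges_iff.1 he with ⟨r, m, hm, hr, rfl⟩ | ⟨r, m, hm, hr, rfl⟩ | ⟨r, m, hm, hr, rfl⟩
    · have : k < r := by unfold outEdge at hk; split_ifs at hk <;> dsimp only at hk <;> omega
      rw [usage_outEdge, hN.eq_zero _ _ (by omega) (by omega), hN.eq_zero _ _ (by omega) (by omega), sub_zero]
    · have : k < r := by simp only [midEdge] at hk; omega
      rw [usage_midEdge, hN.eq_zero _ _ (by omega) (by omega), hN.eq_zero _ _ (by omega) (by omega), sub_zero]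
    · have : k ≤ r := by simp only [slantEdge] at hk; omega
      rw [usage_slantEdge, hN.eq_zero _ _ (by omega) (by omega), hN.eq_zero _ _ (by omega) (by omega), sub_zero]
  omega

/-- Degrees are sums of usages. At an internal vertex the flow is conserved and one side has a
single edge, so both degrees are at most one, and they are nonzero at the vertices retained. The
number of sources telescopes along the left boundary faces to `N 0 0 - N n 0 = i`. -/
theorem IsHeight.subnetwork_mem_paths (hk : k ≤ n) :
    subnetwork n N ∈ ((network n).trunc k).paths i := by
  have hsub : (subnetwork n N).2 ⊆ edges n := Finset.filter_subset _ _
  have hverts : ∀ v ∈ (subnetwork n N).1, v ∈ verts n ∧ v.1 ≤ k ∧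
      (0 < inDegree (subnetwork n N).2 v ∨ 0 < outDegree (subnetwork n N).2 v) := by
    intro v hv
    rcases Finset.mem_union.1 hv with h | h
    · obtain ⟨e, he, rfl⟩ := Finset.mem_image.1 h
      refine ⟨(edge_ends (hsub he)).1, (hN.row_le he).1, Or.inr ?_⟩
      exact Finset.card_pos.2 ⟨e, by simpa [subnetwork] using he⟩
    · obtain ⟨e, he, rfl⟩ := Finset.mem_image.1 h
      refine ⟨(edge_ends (hsub he)).2, (hN.row_le he).2, Or.inl ?_⟩
      exact Finset.card_pos.2 ⟨e, by simpa [subnetwork] using he⟩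
  have hends : ∀ e ∈ (subnetwork n N).2, e.1 ∈ (subnetwork n N).1 ∧ e.2 ∈ (subnetwork n N).1 :=
    fun e he => ⟨Finset.mem_union_left _ (Finset.mem_image_of_mem _ he),
      Finset.mem_union_right _ (Finset.mem_image_of_mem _ he)⟩
  have hin : ∀ v, ∀ e ∈ inEdges n v, usage N e ≤ 1 :=
    fun v e he => hN.usage_le_one (Finset.mem_filter.1 he).1
  have hout : ∀ v, ∀ e ∈ outEdges n v, usage N e ≤ 1 :=
    fun v e he => hN.usage_le_one (Finset.mem_filter.1 he).1
  have hsource : ∀ v ∈ (subnetwork n N).1, v.2 = 0 →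
      inDegree (subnetwork n N).2 v = 0 ∧ outDegree (subnetwork n N).2 v = 1 := by
    rintro ⟨r, c⟩ hv h0
    obtain rfl : c = 0 := h0
    obtain ⟨h1, h2, h3⟩ := hverts _ hv
    have hi := hN.inDegree_eq (r, 0)
    have ho := hN.outDegree_eq (r, 0)
    have hr := mem_verts.1 h1
    have hle := sum_le_one_of_card_le_one (by rw [outEdges_source hr.1 hr.2.1]; simp) (hout (r, 0))
    rw [inEdges_source, Finset.sum_empty] at hi
    omega
  refine mem_paths.2 ⟨⟨⟨?_, ?_, hends⟩, ?_⟩, ?_⟩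
  · exact fun v hv => mem_trunc_verts.2 ⟨(hverts v hv).1, fun _ => (hverts v hv).2.1⟩
  · exact fun e he => mem_trunc_edges.2
      ⟨hsub he, fun _ => (hN.row_le he).1, fun _ => (hN.row_le he).2⟩
  · intro v hv
    obtain ⟨h1, h2, h3⟩ := hverts v hv
    have hi := hN.inDegree_eq v
    have ho := hN.outDegree_eq v
    refine ⟨fun h => hsource v hv (trunc_isSource.1 h).2.1, fun h => ?_, fun h4 h5 => ?_⟩
    · have hs := (trunc_isSink.1 h).2.1
      obtain ⟨r, c⟩ := v
      obtain rfl : c = 2 * r := hs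
      have hr := mem_verts.1 h1
      have hle : ∑ e ∈ inEdges n (r, 2 * r), usage N e ≤ 1 :=
        sum_le_one_of_card_le_one (card_inEdges_sink hr.1 hr.2.1) (hin (r, 2 * r))
      rw [outEdges_sink, Finset.sum_empty] at ho
      omega
    · rw [trunc_isSource] at h4
      rw [trunc_isSink] at h5
      have hc := sum_usage (hN.eq_zero n · hk) h1 (by tauto) (by tauto)
      rcases card_inEdges_or_outEdges h1 with h | h
      · have hle := sum_le_one_of_card_le_one h (hin v)
        omega
      · have hle := sum_le_one_of_card_le_one h (hout v)
        omega
  · have h : (((subnetwork n N).1.filter (fun v => v.2 = 0)).card : ℤ) = i := by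
      have hb : (i : ℤ) = N 0 0 - N n 0 := by rw [hN.base, hN.eq_zero n 0 hk (Nat.zero_le n), sub_zero]
      rw [card_sources fun v hv => (hverts v hv).1, hb, ← Finset.sum_range_sub' (fun r => N r 0)]
      refine Finset.sum_congr rfl fun r hr => ?_
      have hr := Finset.mem_range.1 hr
      have hu := usage_outEdge N n (r + 1) 0
      have hmem : outEdge n (r + 1) 0 ∈ edges n := outEdge_mem.2 ⟨by omega, by omega⟩
      rw [Nat.add_sub_cancel] at hu
      rw [← hu, ← hN.indicator hmem]
      have h1 : (outEdge n (r + 1) 0).1 = (r + 1, 0) := by unfold outEdge; split_ifs <;> rfl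
      refine if_congr ⟨fun hv => ?_, fun he => h1 ▸ (hends _ he).1⟩ rfl rfl
      have hd := (hsource _ hv rfl).2
      have ho := hN.outDegree_eq (r + 1, 0)
      rw [outEdges_source (by omega) (by omega), Finset.sum_singleton] at ho
      exact Finset.mem_filter.2 ⟨hmem, by omega⟩
    exact_mod_cast h

end Height

/-- Slanted edges only descend and the sources above line `k` have been removed: the leftmost vertex
above line `k` would need a predecessor that is at least as high and further left. -/
theorem IsMultipath.row_le {n k : ℕ} {S : Finset (ℕ × ℕ) × Finset ((ℕ × ℕ) × (ℕ × ℕ))}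
    (hS : ((network n).trunc k).IsMultipath S) {v : ℕ × ℕ} (hv : v ∈ S.1) : v.1 ≤ k := by
  by_contra hk
  obtain ⟨w, hw, hmin⟩ := Finset.exists_min_image (S.1.filter (fun v => k < v.1))
    (fun v => ((network n).pos v).1) ⟨v, Finset.mem_filter.2 ⟨hv, by omega⟩⟩
  obtain ⟨hw, hwk⟩ := Finset.mem_filter.1 hw
  have hd : inDegree S.2 w = 1 := by
    by_cases h : ((network n).trunc k).IsSink w
    · exact ((hS.2 w hw).2.1 h).1
    · refine ((hS.2 w hw).2.2 (fun h' => ?_) h).1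
      have := (trunc_isSource.1 h').2.2
      omega
  have hsum := inDegree_eq_sum (fun e he => (mem_trunc_edges.1 (hS.1.2.1 he)).1) w
  rw [hd] at hsum
  obtain ⟨e, he, hne⟩ := Finset.exists_ne_zero_of_sum_ne_zero (by rw [← hsum]; exact one_ne_zero)
  obtain ⟨hE, rfl⟩ := Finset.mem_filter.1 he
  have he : e ∈ S.2 := by
    by_contra h
    simp [h] at hne
  have hlt := (network n).left_to_right e hE
  have hrow : e.2.1 ≤ e.1.1 := by
    rcases edge_cases hE with h | h <;> omega
  have := hmin e.1 (Finset.mem_filter.2 ⟨(hS.1.2.2 e he).1, by omega⟩)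
  linarith

/-- The height function of an `i`-path. -/
theorem exists_isHeight {n k i : ℕ} (hk : k ≤ n) {S : Finset (ℕ × ℕ) × Finset ((ℕ × ℕ) × (ℕ × ℕ))}
    (hS : S ∈ ((network n).trunc k).paths i) :
    ∃ N, IsHeight n k i N ∧ ∀ e ∈ edges n, (if e ∈ S.2 then (1 : ℤ) else 0) = usage N e := by
  obtain ⟨hM, hi⟩ := mem_paths.1 hS
  have hsub : S.2 ⊆ edges n := fun e he => (mem_trunc_edges.1 (hM.1.2.1 he)).1
  have hends := hM.1.2.2
  set x : (ℕ × ℕ) × (ℕ × ℕ) → ℤ := fun e => if e ∈ S.2 then 1 else 0 with hx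
  have hx0 : ∀ e, e ∉ S.2 → x e = 0 := fun e he => if_neg he
  have hcons : ∀ v ∈ verts n, v.2 ≠ 0 → v.2 ≠ 2 * v.1 →
      ∑ e ∈ inEdges n v, x e = ∑ e ∈ outEdges n v, x e := by
    intro v _ h0 h1
    by_cases hv : v ∈ S.1
    · have h := (hM.2 v hv).2.2 (fun h => h0 (trunc_isSource.1 h).2.1)
        (fun h => h1 (trunc_isSink.1 h).2.1)
      rw [← inDegree_eq_sum hsub, ← outDegree_eq_sum hsub, h.1, h.2]
    · rw [Finset.sum_eq_zero, Finset.sum_eq_zero]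
      · intro e he
        refine hx0 e fun h => hv ?_
        rw [← (Finset.mem_filter.1 he).2]
        exact (hends e h).1
      · intro e he
        refine hx0 e fun h => hv ?_
        rw [← (Finset.mem_filter.1 he).2]
        exact (hends e h).2
  -- Walk straight up from the face `(j, m)` through the edges `outEdge n r m`, crossing no slanted
  -- edge, and count the paths met. For `m ≥ r` there is no such edge and the term is `0`.
  set N : ℕ → ℕ → ℤ := fun j m => ∑ r ∈ Finset.Ico (j + 1) (n + 1), x (outEdge n r m) with hN
  have hstep : ∀ j m, j < n → N j m = x (outEdge n (j + 1) m) + N (j + 1) m := by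
    intro j m hj
    simp only [hN]
    rw [Finset.sum_eq_sum_Ico_succ_bot (by omega)]
  have htop : ∀ j m, n ≤ j → N j m = 0 := by
    intro j m hj
    simp only [hN]
    rw [Finset.Ico_eq_empty (by omega), Finset.sum_empty]
  -- Induction downwards from the top line. Conservation at both ends of the middle edge of line `j
  -- + 1` expresses the usage of `slantEdge j m` through that of `slantEdge (j + 1) m` and two
  -- out-edges.
  have hslant : ∀ d j m, j + d = n → m < j → x (slantEdge j m) = N j m - N j (m + 1) := by
    intro d
    induction d with
    | zero =>
      intro j m hj hm
      rw [htop j m (by omega), htop j (m + 1) (by omega), sub_zero]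
      exact hx0 _ fun h => by have := slantEdge_mem.1 (hsub h); omega
    | succ d ih =>
      intro j m hj hm
      have hc := hcons (j + 1, 2 * m + 2)
        (mem_verts.2 ⟨by dsimp only; omega, by dsimp only; omega, by dsimp only; omega,
          by dsimp only; omega⟩) (by dsimp only; omega) (by dsimp only; omega)
      rw [outEdges_even hm (by omega), Finset.sum_pair outEdge_ne_slantEdge] at hc
      rw [hstep j m (by omega), hstep j (m + 1) (by omega)]
      rcases Nat.lt_or_ge (j + 1) n with h | h
      · rw [inEdges_even (by omega) h, Finset.sum_singleton] at hc
        have hc' := hcons (j + 1, 2 * m + 1)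
          (mem_verts.2 ⟨by dsimp only; omega, by dsimp only; omega, by dsimp only; omega,
            by dsimp only; omega⟩) (by dsimp only; omega) (by dsimp only; omega)
        rw [outEdges_odd (by omega) h, inEdges_odd (by omega) h, Finset.sum_singleton,
          Finset.sum_pair outEdge_ne_slantEdge, ih (j + 1) m (by omega) (by omega)] at hc'
        linarith
      · obtain rfl : n = j + 1 := by omega
        rw [inEdges_top (by omega), Finset.sum_singleton] at hc
        rw [htop (j + 1) m le_rfl, htop (j + 1) (m + 1) le_rfl]
        linarith
  have husage : ∀ e ∈ edges n, x e = usage N e := by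
    intro e he
    rcases mem_edges_iff.1 he with ⟨r, m, hm, hr, rfl⟩ | ⟨r, m, hm, hr, rfl⟩ | ⟨r, m, hm, hr, rfl⟩
    · have := hstep (r - 1) m (by omega)
      rw [Nat.sub_add_cancel (by omega)] at this
      rw [usage_outEdge]
      linarith
    · have h1 := hstep (r - 1) m (by omega)
      rw [Nat.sub_add_cancel (by omega)] at h1
      have hc := hcons (r, 2 * m + 1)
        (mem_verts.2 ⟨by dsimp only; omega, by dsimp only; omega, by dsimp only; omega,
          by dsimp only; omega⟩) (by dsimp only; omega) (by dsimp only; omega)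
      rw [outEdges_odd hm hr, inEdges_odd hm hr, Finset.sum_singleton,
        Finset.sum_pair outEdge_ne_slantEdge, hslant (n - r) r m (by omega) hm] at hc
      rw [usage_midEdge]
      linarith
    · rw [usage_slantEdge]
      exact hslant (n - r) r m (by omega) hm
  refine ⟨N, ⟨?_, ?_, fun e he => ?_⟩, husage⟩
  · intro j m hj _
    refine Finset.sum_eq_zero fun r hr => hx0 _ fun h => ?_
    have h1 := IsMultipath.row_le hM (hends _ h).1
    have h2 : (outEdge n r m).1.1 = r := by unfold outEdge; split_ifs <;> rfl
    have h3 := Finset.mem_Ico.1 hr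
    omega
  · have hv : S.1 ⊆ verts n := fun v hv => (mem_trunc_verts.1 (hM.1.1 hv)).1
    rw [← hi, card_sources hv, hN]
    dsimp only
    rw [Finset.range_eq_Ico, Finset.sum_Ico_add' (fun r => if (r, 0) ∈ S.1 then (1 : ℤ) else 0) 0 n 1]
    refine Finset.sum_congr rfl fun r hr => ?_
    have h3 := Finset.mem_Ico.1 hr
    have h1 : (outEdge n r 0).1 = (r, 0) := by unfold outEdge; split_ifs <;> rfl
    refine if_congr ⟨fun he => h1 ▸ (hends _ he).1, fun h => ?_⟩ rfl rfl
    have hs : ((network n).trunc k).IsSource (r, 0) :=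
      trunc_isSource.2 ⟨hv h, rfl, IsMultipath.row_le hM h⟩
    have hd := outDegree_eq_sum hsub (r, 0)
    rw [((hM.2 _ h).1 hs).2, outEdges_source (by omega) (by omega), Finset.sum_singleton] at hd
    by_contra hne
    simp [hne] at hd
  · rw [← husage e he]
    simp only [hx]
    split_ifs <;> simp

/-! ### Maximal weights as maxima over height functions -/

/-- The total weight of the edges, counted with their usage. -/
noncomputable def heightWeight (n : ℕ) (w : (ℕ × ℕ) × (ℕ × ℕ) → ℝ) (N : ℕ → ℕ → ℤ) : ℝ :=
  ∑ e ∈ edges n, w e * usage N e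

theorem weight_eq_heightWeight {n k i : ℕ} (w : (ℕ × ℕ) × (ℕ × ℕ) → ℝ)
    {S : Finset (ℕ × ℕ) × Finset ((ℕ × ℕ) × (ℕ × ℕ))} (hS : S ∈ ((network n).trunc k).paths i)
    {N : ℕ → ℕ → ℤ} (hN : ∀ e ∈ edges n, (if e ∈ S.2 then (1 : ℤ) else 0) = usage N e) :
    ((network n).trunc k).weight (((network n).trunc k).realWeighting w) S =
      (heightWeight n w N : TropReal) := by
  have hM := (mem_paths.1 hS).1
  have hsub : S.2 ⊆ edges n := fun e he => (mem_trunc_edges.1 (hM.1.2.1 he)).1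
  rw [weight_realWeighting _ _ hM.1.2.1, heightWeight, ← Finset.sum_subset hsub]
  · congr 1
    refine Finset.sum_congr rfl fun e he => ?_
    rw [← hN e (hsub he), if_pos he, Int.cast_one, mul_one]
  · intro e he hne
    rw [← hN e he, if_neg hne, Int.cast_zero, mul_zero]

section Height

variable {n k i : ℕ} {N : ℕ → ℕ → ℤ} (hN : IsHeight n k i N)
include hN

theorem IsHeight.row_antitone {r m : ℕ} (hm : m ≤ r) (hr : r < n) : N (r + 1) m ≤ N r m := by
  have h := hN.usage_nonneg (outEdge_mem.2 ⟨(by omega : m < r + 1), (by omega : r + 1 ≤ n)⟩)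
  rw [usage_outEdge, Nat.add_sub_cancel] at h
  omega

/-- The two faces are separated by the middle edge of line `r + 1`, whose usage is at most one. The
top line has no such edge, but there `N` vanishes above it and an out-edge serves instead. -/
theorem IsHeight.le_add_one {r m : ℕ} (hk : k ≤ n) (hm : m ≤ r) (hr : r < n) :
    N r m ≤ N (r + 1) (m + 1) + 1 := by
  rcases Nat.lt_or_ge (r + 1) n with h | h
  · have h := hN.usage_le_one (midEdge_mem.2 ⟨(by omega : m < r + 1), h⟩)
    rw [usage_midEdge, Nat.add_sub_cancel] at h
    omega
  · have h1 := hN.usage_le_one (outEdge_mem.2 ⟨(by omega : m < r + 1), (by omega : r + 1 ≤ n)⟩)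
    rw [usage_outEdge, Nat.add_sub_cancel, hN.eq_zero (r + 1) m (by omega) (by omega)] at h1
    rw [hN.eq_zero (r + 1) (m + 1) (by omega) (by omega)]
    omega

end Height

/-- Makes the convention `l_0 = 0` agree with the maximum over height functions. Nonnegative usages
make `N` decrease upwards and to the right, so it is squeezed between the value `0` at the bottom
left and the value `0` above the top line. -/
theorem heightWeight_of_isHeight_zero {n k : ℕ} (hk : k ≤ n) {N : ℕ → ℕ → ℤ}
    (hN : IsHeight n k 0 N) (w : (ℕ × ℕ) × (ℕ × ℕ) → ℝ) : heightWeight n w N = 0 := by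
  have hrow : ∀ j ≤ n, N j 0 ≤ 0 := by
    intro j
    induction j with
    | zero => intro _; rw [hN.base]; simp
    | succ j ih => intro hj; exact (hN.row_antitone (Nat.zero_le j) hj).trans (ih (by omega))
  have hle : ∀ m j, m ≤ j → j ≤ n → N j m ≤ 0 := by
    intro m
    induction m with
    | zero => exact fun j _ => hrow j
    | succ m ih =>
      intro j hm hj
      rcases hj.lt_or_eq with h | h
      · have h := hN.usage_nonneg (slantEdge_mem.2 ⟨(by omega : m < j), h⟩)
        rw [usage_slantEdge] at h
        have := ih j (by omega) hj
        omega
      · rw [hN.eq_zero j _ (by omega) hm]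
  have hge : ∀ d m j, m ≤ j → j + d = n → 0 ≤ N j m := by
    intro d
    induction d with
    | zero => intro m j hm hj; rw [hN.eq_zero j m (by omega) hm]
    | succ d ih =>
      intro m j hm hj
      exact (ih m (j + 1) (by omega) (by omega)).trans (hN.row_antitone hm (by omega))
  have hz : ∀ m j, m ≤ j → j ≤ n → N j m = 0 := fun m j hm hj =>
    le_antisymm (hle m j hm hj) (hge (n - j) m j hm (by omega))
  refine Finset.sum_eq_zero fun e he => ?_
  have : usage N e = 0 := by
    rcases mem_edges_iff.1 he with ⟨r, m, hm, hr, rfl⟩ | ⟨r, m, hm, hr, rfl⟩ | ⟨r, m, hm, hr, rfl⟩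
    · rw [usage_outEdge, hz _ _ (by omega) (by omega), hz _ _ (by omega) (by omega), sub_zero]
    · rw [usage_midEdge, hz _ _ (by omega) (by omega), hz _ _ (by omega) (by omega), sub_zero]
    · rw [usage_slantEdge, hz _ _ (by omega) (by omega), hz _ _ (by omega) (by omega), sub_zero]
  rw [this, Int.cast_zero, mul_zero]

theorem heightWeight_le_l {n k i : ℕ} (hk : k ≤ n) {N : ℕ → ℕ → ℤ} (hN : IsHeight n k i N)
    (w : (ℕ × ℕ) × (ℕ × ℕ) → ℝ) :
    (heightWeight n w N : TropReal) ≤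
      ((network n).trunc k).l i (((network n).trunc k).realWeighting w) := by
  rw [l]
  split_ifs with hi
  · subst hi
    rw [heightWeight_of_isHeight_zero hk hN]
    rfl
  · have hS := hN.subnetwork_mem_paths hk
    rw [← weight_eq_heightWeight w hS fun e he => hN.indicator he]
    exact Finset.le_sup (f := ((network n).trunc k).weight _) hS

/-- The height function of the `i`-path that leads from the sources `k - i + 1, …, k` to the sinks
`1, …, i`. -/
def staircase (k i j m : ℕ) : ℤ := (min (i - m) (k - j) : ℕ)

theorem isHeight_staircase {n k i : ℕ} (hi : i ≤ k) : IsHeight n k i (staircase k i) := by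
  refine ⟨fun j m hj _ => ?_, ?_, fun e he => ?_⟩
  · simp only [staircase]
    omega
  · simp only [staircase]
    omega
  · rcases mem_edges_iff.1 he with ⟨r, m, hm, hr, rfl⟩ | ⟨r, m, hm, hr, rfl⟩ | ⟨r, m, hm, hr, rfl⟩
    · rw [usage_outEdge, staircase, staircase]
      omega
    · rw [usage_midEdge, staircase, staircase]
      omega
    · rw [usage_slantEdge, staircase, staircase]
      omega

/-- The staircase provides an `i`-path, so for `i > 0` the supremum is over a nonempty finite set
and is attained. In particular it is a real number, and the default value in `maxWeight` plays no
role for `i ≤ k ≤ n`. -/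
theorem exists_l_eq {n k i : ℕ} (hk : k ≤ n) (hi : i ≤ k) (w : (ℕ × ℕ) × (ℕ × ℕ) → ℝ) :
    ∃ N, IsHeight n k i N ∧ ((network n).trunc k).l i (((network n).trunc k).realWeighting w) =
      (heightWeight n w N : TropReal) := by
  rw [l]
  split_ifs with h0
  · subst h0
    have hN := isHeight_staircase (n := n) hi
    exact ⟨_, hN, by rw [heightWeight_of_isHeight_zero hk hN]; rfl⟩
  · have hne := (isHeight_staircase (n := n) hi).subnetwork_mem_paths hk
    obtain ⟨S, hS, h⟩ := Finset.exists_mem_eq_sup _ ⟨_, hne⟩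
      (((network n).trunc k).weight (((network n).trunc k).realWeighting w))
    obtain ⟨N, hN, hu⟩ := exists_isHeight hk hS
    exact ⟨N, hN, by rw [h, weight_eq_heightWeight w hS hu]⟩

/-- The real value of `l_i` of the `k`-th truncation. -/
noncomputable def maxWeight (n : ℕ) (w : (ℕ × ℕ) × (ℕ × ℕ) → ℝ) (k i : ℕ) : ℝ :=
  (((network n).trunc k).l i (((network n).trunc k).realWeighting w)).unbotD 0

theorem coe_maxWeight {n k i : ℕ} (hk : k ≤ n) (hi : i ≤ k) (w : (ℕ × ℕ) × (ℕ × ℕ) → ℝ) :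
    (maxWeight n w k i : TropReal) =
      ((network n).trunc k).l i (((network n).trunc k).realWeighting w) := by
  obtain ⟨N, -, h⟩ := exists_l_eq hk hi w
  rw [maxWeight, h]
  rfl

theorem heightWeight_le_maxWeight {n k i : ℕ} (hk : k ≤ n) (hi : i ≤ k) {N : ℕ → ℕ → ℤ}
    (hN : IsHeight n k i N) (w : (ℕ × ℕ) × (ℕ × ℕ) → ℝ) :
    heightWeight n w N ≤ maxWeight n w k i := by
  have h := heightWeight_le_l hk hN w
  rw [← coe_maxWeight hk hi] at h
  exact WithBot.coe_le_coe.1 h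

theorem exists_maxWeight_eq {n k i : ℕ} (hk : k ≤ n) (hi : i ≤ k) (w : (ℕ × ℕ) × (ℕ × ℕ) → ℝ) :
    ∃ N, IsHeight n k i N ∧ maxWeight n w k i = heightWeight n w N := by
  obtain ⟨N, hN, h⟩ := exists_l_eq hk hi w
  rw [← coe_maxWeight hk hi] at h
  exact ⟨N, hN, WithBot.coe_inj.1 h⟩

/-! ### Exchange inequalities: real weightings land in the cone -/

theorem usage_add (M N : ℕ → ℕ → ℤ) (e : (ℕ × ℕ) × (ℕ × ℕ)) :
    usage (M + N) e = usage M e + usage N e := by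
  unfold usage
  split_ifs <;> simp only [Pi.add_apply] <;> ring

theorem heightWeight_add (n : ℕ) (w : (ℕ × ℕ) × (ℕ × ℕ) → ℝ) (M N : ℕ → ℕ → ℤ) :
    heightWeight n w (M + N) = heightWeight n w M + heightWeight n w N := by
  simp only [heightWeight, ← Finset.sum_add_distrib, usage_add]
  exact Finset.sum_congr rfl fun e _ => by push_cast; ring

/-- The jump of `M + N + c` across an edge is `0`, `1` or `2`, so after halving and rounding down it
is `0` or `1`, whatever the parity. -/
theorem usage_half {M N : ℕ → ℕ → ℤ} {e : (ℕ × ℕ) × (ℕ × ℕ)} (c : ℤ)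
    (hM : usage M e = 0 ∨ usage M e = 1) (hN : usage N e = 0 ∨ usage N e = 1) :
    usage (fun j m => (M j m + N j m + c) / 2) e = 0 ∨
      usage (fun j m => (M j m + N j m + c) / 2) e = 1 := by
  unfold usage at *
  dsimp only
  split_ifs at * <;> omega

/-- Rounding the midpoint of the height functions of two multipaths down and up gives two multipaths
with the same superposition and balanced numbers of paths. -/
theorem exchange {n k a b : ℕ} (hk : k < n) (ha : a ≤ k + 1) (hb : b ≤ k)
    (w : (ℕ × ℕ) × (ℕ × ℕ) → ℝ) :
    maxWeight n w (k + 1) a + maxWeight n w k b ≤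
      maxWeight n w (k + 1) ((a + b + 1) / 2) + maxWeight n w k ((a + b) / 2) := by
  obtain ⟨M, hM, h1⟩ := exists_maxWeight_eq hk ha w
  obtain ⟨N, hN, h2⟩ := exists_maxWeight_eq hk.le hb w
  have hup : IsHeight n (k + 1) ((a + b + 1) / 2) (fun j m => (M j m + N j m + 1) / 2) := by
    refine ⟨fun j m hj hm => ?_, ?_, fun e he => usage_half 1 (hM.usage_mem e he) (hN.usage_mem e he)⟩
    · rw [hM.eq_zero j m hj hm, hN.eq_zero j m (by omega) hm]
      rfl
    · rw [hM.base, hN.base]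
      push_cast
      rfl
  have hdown : IsHeight n k ((a + b) / 2) (fun j m => (M j m + N j m + 0) / 2) := by
    refine ⟨fun j m hj hm => ?_, ?_, fun e he => usage_half 0 (hM.usage_mem e he) (hN.usage_mem e he)⟩
    · rw [hN.eq_zero j m hj hm]
      rcases hj.lt_or_eq with h | rfl
      · rw [hM.eq_zero j m h hm]
        rfl
      -- On row `k` the function `N` vanishes and `M` is at most `1`, being one jump away from the
      -- zero row `k + 1`. Rounding down therefore yields `0`, which is why the lower rounding
      -- belongs to `Γ^(k)`.
      · have h := hM.usage_mem _ (outEdge_mem.2 ⟨Nat.lt_succ_of_le hm, hk⟩)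
        rw [usage_outEdge, hM.eq_zero (k + 1) m le_rfl (by omega), Nat.succ_sub_one] at h
        omega
    · rw [hM.base, hN.base]
      push_cast
      simp
  have hsum : (fun j m => (M j m + N j m + 1) / 2) + (fun j m => (M j m + N j m + 0) / 2) = M + N := by
    funext j m
    simp only [Pi.add_apply]
    omega
  have h3 := heightWeight_le_maxWeight hk (by omega) hup w
  have h4 := heightWeight_le_maxWeight hk.le (by omega) hdown w
  have h5 := heightWeight_add n w M N
  rw [← hsum, heightWeight_add] at h5
  linarith

theorem L_realWeighting_mem (n : ℕ) (w : (ℕ × ℕ) × (ℕ × ℕ) → ℝ) :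
    (network n).L n ((network n).realWeighting w) ∈ tropTableau '' coneC2 n := by
  refine ⟨fun p => maxWeight n w p.1.1 p.1.2, fun k i h0 hik hk => ⟨?_, ?_⟩, ?_⟩
  -- The index sum `2i - 1` is odd, so the rounded halves are `i` in row `k + 1` and `i - 1` in row
  -- `k`; in the second inequality the sum is `2i` and both halves are `i`.
  · have h := exchange (a := i - 1) (b := i) hk (by omega) hik w
    rw [show (i - 1 + i + 1) / 2 = i by omega, show (i - 1 + i) / 2 = i - 1 by omega] at h
    exact h
  · have h := exchange (a := i + 1) (b := i - 1) hk (by omega) (by omega) w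
    rw [show (i + 1 + (i - 1) + 1) / 2 = i by omega, show (i + 1 + (i - 1)) / 2 = i by omega] at h
    exact h
  · funext p
    exact coe_maxWeight p.2.2 p.2.1 w

/-! ### A weighting realizing an interlacing tableau -/

/-- The interlacing inequalities for the differences of consecutive entries in each row of a tableau
that vanishes in its first column. -/
structure IsInterlacing (n : ℕ) (T : ℕ → ℕ → ℝ) : Prop where
  zero : ∀ k ≤ n, T k 0 = 0
  mono : ∀ k m, m < k → k < n → T k (m + 1) - T k m ≤ T (k + 1) (m + 1) - T (k + 1) m
  interlace : ∀ k m, m < k → k < n → T (k + 1) (m + 2) - T (k + 1) (m + 1) ≤ T k (m + 1) - T k m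

/-- The difference of consecutive entries of a row. -/
def rowDiff (T : ℕ → ℕ → ℝ) (k m : ℕ) : ℝ := T k (m + 1) - T k m

/-- The weight of the edge leading to the right from `(r, 2 * m)`. -/
def outWeight (T : ℕ → ℕ → ℝ) (r : ℕ) : ℕ → ℝ
  | 0 => rowDiff T r 0
  | m + 1 => rowDiff T r (m + 1) - rowDiff T (r - 1) m

/-- A weighting that is mapped to the tableau `T`. -/
def tableauWeighting (T : ℕ → ℕ → ℝ) (e : (ℕ × ℕ) × (ℕ × ℕ)) : ℝ :=
  if e.2.1 = e.1.1 ∧ e.1.2 % 2 = 0 then outWeight T e.1.1 (e.1.2 / 2) else 0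

theorem tableauWeighting_outEdge (T : ℕ → ℕ → ℝ) (n r m : ℕ) :
    tableauWeighting T (outEdge n r m) = outWeight T r m := by
  unfold tableauWeighting outEdge
  split_ifs <;> simp at *

theorem tableauWeighting_midEdge (T : ℕ → ℕ → ℝ) (r m : ℕ) :
    tableauWeighting T (midEdge r m) = 0 := by
  simp [tableauWeighting, midEdge, Nat.add_mod]

theorem tableauWeighting_slantEdge (T : ℕ → ℕ → ℝ) (r m : ℕ) :
    tableauWeighting T (slantEdge r m) = 0 := by
  simp [tableauWeighting, slantEdge]

theorem heightWeight_tableauWeighting (n : ℕ) (T : ℕ → ℕ → ℝ) (N : ℕ → ℕ → ℤ) :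
    heightWeight n (tableauWeighting T) N =
      ∑ r ∈ Finset.range n, ∑ m ∈ Finset.range (r + 1),
        outWeight T (r + 1) m * (N r m - N (r + 1) m : ℤ) := by
  rw [Finset.sum_sigma', heightWeight]
  symm
  refine Finset.sum_of_injOn (fun p => outEdge n (p.1 + 1) p.2) ?_ ?_ ?_ ?_
  · rintro ⟨r, m⟩ - ⟨s, p⟩ - h
    have h1 := congrArg (fun e => e.1) h
    have h2 : ∀ r m, (outEdge n r m).1 = (r, 2 * m) := fun r m => by
      unfold outEdge
      split_ifs <;> rfl
    simp only [h2, Prod.mk.injEq] at h1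
    obtain rfl : r = s := by omega
    obtain rfl : m = p := by omega
    rfl
  · rintro ⟨r, m⟩ h
    simp only [Finset.coe_sigma, Finset.coe_range, Set.mem_sigma_iff, Set.mem_Iio] at h
    exact outEdge_mem.2 ⟨h.2, h.1⟩
  · intro e he hne
    rcases mem_edges_iff.1 he with ⟨r, m, hm, hr, rfl⟩ | ⟨r, m, hm, hr, rfl⟩ | ⟨r, m, hm, hr, rfl⟩
    · refine absurd ⟨⟨r - 1, m⟩, ?_, ?_⟩ hne
      · simp only [Finset.coe_sigma, Finset.coe_range, Set.mem_sigma_iff, Set.mem_Iio]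
        omega
      · dsimp only
        rw [Nat.sub_add_cancel (by omega)]
    · rw [tableauWeighting_midEdge, zero_mul]
    · rw [tableauWeighting_slantEdge, zero_mul]
  · rintro ⟨r, m⟩ -
    rw [tableauWeighting_outEdge, usage_outEdge, Nat.add_sub_cancel]

variable {n : ℕ} {T : ℕ → ℕ → ℝ}

/-- The two rows telescope separately. The truncated `q - 1` is harmless at `q = 0` because the
first column vanishes. -/
theorem sum_outWeight (T : ℕ → ℕ → ℝ) (r q : ℕ) (h0 : T (r + 1) 0 = 0) (h1 : T r 0 = 0) :
    ∑ m ∈ Finset.range q, outWeight T (r + 1) m = T (r + 1) q - T r (q - 1) := by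
  induction q with
  | zero => simp [h0, h1]
  | succ q ih =>
    rw [Finset.sum_range_succ, ih]
    cases q with
    | zero => simp [outWeight, rowDiff, h0, h1]
    | succ q => simp only [outWeight, rowDiff, Nat.add_sub_cancel]; ring

/-- On line `r + 1` with `r < k` the staircase uses exactly the first `i + (r + 1) - k` out-edges,
so this line contributes a difference of tableau entries on one diagonal; the sum over lines
telescopes to `T k i - T 0 0`. -/
theorem heightWeight_staircase (hT : IsInterlacing n T) {k i : ℕ} (hk : k ≤ n) (hi : i ≤ k) :
    heightWeight n (tableauWeighting T) (staircase k i) = T k i := by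
  rw [heightWeight_tableauWeighting, ← Finset.sum_subset (Finset.range_subset_range.2 hk)]
  · have hrow : ∀ r ∈ Finset.range k, ∑ m ∈ Finset.range (r + 1),
        outWeight T (r + 1) m * (staircase k i r m - staircase k i (r + 1) m : ℤ) =
          T (r + 1) (i + (r + 1) - k) - T r (i + r - k) := by
      intro r hr
      have hr := Finset.mem_range.1 hr
      have hq : i + r - k = i + (r + 1) - k - 1 := by omega
      rw [hq, ← sum_outWeight T r _ (hT.zero _ (by omega)) (hT.zero _ (by omega)), eq_comm]
      refine Finset.sum_subset_zero_on_sdiff (Finset.range_subset_range.2 (by omega)) ?_ ?_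
      · intro m hm
        simp only [Finset.mem_sdiff, Finset.mem_range] at hm
        have h : staircase k i r m - staircase k i (r + 1) m = 0 := by
          unfold staircase
          omega
        rw [h, Int.cast_zero, mul_zero]
      · intro m hm
        have hm := Finset.mem_range.1 hm
        have h : staircase k i r m - staircase k i (r + 1) m = 1 := by
          unfold staircase
          omega
        rw [h, Int.cast_one, mul_one]
    rw [Finset.sum_congr rfl hrow, Finset.sum_range_sub (fun r => T r (i + r - k))]
    simp only [Nat.add_sub_cancel, add_zero]
    rw [Nat.sub_eq_zero_of_le hi, hT.zero 0 (Nat.zero_le n), sub_zero]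
  · intro r _ hr
    have hr : k ≤ r := by simpa using hr
    refine Finset.sum_eq_zero fun m _ => ?_
    have h : staircase k i r m - staircase k i (r + 1) m = 0 := by
      unfold staircase
      omega
    rw [h, Int.cast_zero, mul_zero]

/-! ### Weak duality: no multipath beats the tableau -/

/-- The dual bound for flows on the lines up to `K`. -/
theorem IsHeight.partial_bound (hT : IsInterlacing n T) {k i : ℕ} (hk : k ≤ n) {N : ℕ → ℕ → ℤ}
    (hN : IsHeight n k i N) (C : ℝ) {K : ℕ} (hK : K ≤ n) :
    ∑ r ∈ Finset.range K, ∑ m ∈ Finset.range (r + 1),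
        outWeight T (r + 1) m * (N r m - N (r + 1) m : ℤ) ≤
      C * (N 0 0 - N K K : ℤ) +
        ∑ m ∈ Finset.range K, ((max (rowDiff T K m) C - C) -
          max (rowDiff T K m) C * (N K m - N K (m + 1) : ℤ)) := by
  induction K with
  | zero => simp
  | succ K ih =>
    rw [Finset.sum_range_succ]
    refine (add_le_add_left (ih (by omega)) _).trans ?_
    set μ : ℕ → ℝ := fun m => max (rowDiff T K m) C with hμ
    set μ' : ℕ → ℝ := fun m => max (rowDiff T (K + 1) m) C with hμ'
    -- By interlacing, `λ^{K+1}_{m+1} - λ^K_m ≤ 0`, and truncation from below at `C` is a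
    -- contraction, so replacing `λ` by `μ` can only increase these weights. The usages are
    -- nonnegative.
    have hrow : ∑ m ∈ Finset.range (K + 1), outWeight T (K + 1) m * (N K m - N (K + 1) m : ℤ) ≤
        ∑ m ∈ Finset.range K, (μ' m * (N K m - N (K + 1) m : ℤ) -
          μ m * (N K (m + 1) - N (K + 1) (m + 1) : ℤ)) + μ' K * (N K K - N (K + 1) K : ℤ) := by
      have hpos : ∀ m ≤ K, (0 : ℝ) ≤ (N K m - N (K + 1) m : ℤ) := fun m hm => by
        have := hN.row_antitone hm (by omega : K < n)
        exact_mod_cast (by omega : 0 ≤ N K m - N (K + 1) m)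
      rw [Finset.sum_sub_distrib, sub_add_eq_add_sub,
        ← Finset.sum_range_succ (fun m => μ' m * (N K m - N (K + 1) m : ℤ)), Finset.sum_range_succ',
        Finset.sum_range_succ' (fun m => μ' m * (N K m - N (K + 1) m : ℤ)), add_sub_right_comm,
        ← Finset.sum_sub_distrib]
      refine add_le_add (Finset.sum_le_sum fun m hm => ?_) ?_
      · have hm := Finset.mem_range.1 hm
        rw [← sub_mul]
        refine mul_le_mul_of_nonneg_right ?_ (hpos (m + 1) hm)
        have h := hT.interlace K m hm (by omega)
        simp only [outWeight, Nat.add_sub_cancel, hμ, hμ']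
        simp only [rowDiff] at *
        rcases max_cases (T K (m + 1) - T K m) C with h1 | h1 <;>
          rcases max_cases (T (K + 1) (m + 1 + 1) - T (K + 1) (m + 1)) C with h2 | h2 <;> linarith
      · exact mul_le_mul_of_nonneg_right (le_max_left _ _) (hpos 0 (Nat.zero_le K))
    refine (add_le_add_right hrow _).trans ?_
    rw [Finset.sum_range_succ _ K]
    -- The right side minus the left side is `(μ' m - μ m) * (1 + N (K + 1) (m + 1) - N K m)`, a
    -- product of nonnegative factors.
    have hterm : ∀ m ∈ Finset.range K, ((μ m - C) - μ m * (N K m - N K (m + 1) : ℤ)) +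
        (μ' m * (N K m - N (K + 1) m : ℤ) - μ m * (N K (m + 1) - N (K + 1) (m + 1) : ℤ)) ≤
          (μ' m - C) - μ' m * (N (K + 1) m - N (K + 1) (m + 1) : ℤ) := by
      intro m hm
      have hm := Finset.mem_range.1 hm
      have h1 : (N K m : ℝ) ≤ N (K + 1) (m + 1) + 1 := by
        exact_mod_cast hN.le_add_one hk hm.le (by omega : K < n)
      have h2 : μ m ≤ μ' m := max_le_max (hT.mono K m hm (by omega)) le_rfl
      push_cast
      nlinarith [mul_nonneg (sub_nonneg.2 h1) (sub_nonneg.2 h2)]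
    -- The boundary term `m = K` works the same way with `C` in place of the missing `μ K`.
    have hlast : (N K K : ℝ) ≤ N (K + 1) (K + 1) + 1 := by
      exact_mod_cast hN.le_add_one hk le_rfl (by omega : K < n)
    have hC : C ≤ μ' K := le_max_right _ _
    have hsum := Finset.sum_le_sum hterm
    rw [Finset.sum_add_distrib] at hsum
    push_cast at hsum ⊢
    nlinarith [mul_nonneg (sub_nonneg.2 hlast) (sub_nonneg.2 hC)]

theorem IsInterlacing.rowDiff_antitone (hT : IsInterlacing n T) {k p q : ℕ} (hk : k ≤ n) (hpq : p ≤ q)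
    (hq : q < k) : rowDiff T k q ≤ rowDiff T k p := by
  induction hpq with
  | refl => exact le_rfl
  | @step q _ ih =>
    obtain ⟨k, rfl⟩ : ∃ j, k = j + 1 := ⟨k - 1, by omega⟩
    exact ((hT.interlace k q (by omega) hk).trans (hT.mono k q (by omega) hk)).trans (ih (by omega))

/-- The dual variable `C` is the `i`-th difference of row `k`. Since row differences decrease, `max
(rowDiff T k m) C - C` vanishes for `m ≥ i`, and the dual bound collapses to `i C + ∑_{m < i}
(rowDiff T k m - C) = T k i`. -/
theorem IsHeight.heightWeight_le (hT : IsInterlacing n T) {k i : ℕ} (hk : k ≤ n) (hi : i ≤ k)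
    {N : ℕ → ℕ → ℤ} (hN : IsHeight n k i N) : heightWeight n (tableauWeighting T) N ≤ T k i := by
  rcases Nat.eq_zero_or_pos i with rfl | h0
  · rw [heightWeight_of_isHeight_zero hk hN, hT.zero k hk]
  rw [heightWeight_tableauWeighting, ← Finset.sum_subset (Finset.range_subset_range.2 hk)]
  · set C := rowDiff T k (i - 1) with hC
    refine (hN.partial_bound hT hk C hk).trans ?_
    have hterm : ∀ m ∈ Finset.range k, ((max (rowDiff T k m) C - C) -
        max (rowDiff T k m) C * (N k m - N k (m + 1) : ℤ)) =
          if m < i then rowDiff T k m - C else 0 := by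
      intro m hm
      have hm := Finset.mem_range.1 hm
      rw [hN.eq_zero k m le_rfl hm.le, hN.eq_zero k (m + 1) le_rfl hm]
      split_ifs with h
      · rw [max_eq_left (hT.rowDiff_antitone hk (by omega) (by omega))]
        simp
      · rw [max_eq_right (hT.rowDiff_antitone hk (by omega) (by omega))]
        simp [hC]
    have hfilter : (Finset.range k).filter (· < i) = Finset.range i := by
      ext m
      simp only [Finset.mem_filter, Finset.mem_range]
      omega
    rw [Finset.sum_congr rfl hterm, ← Finset.sum_filter, hfilter, Finset.sum_sub_distrib, hN.base,
      hN.eq_zero k k le_rfl le_rfl]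
    simp only [rowDiff, Finset.sum_range_sub (T k), Finset.sum_const, Finset.card_range, hT.zero k hk]
    simp [mul_comm]
  · intro r hr hr'
    have hr := Finset.mem_range.1 hr
    have hr' : k ≤ r := by simpa using hr'
    refine Finset.sum_eq_zero fun m hm => ?_
    have hm := Finset.mem_range.1 hm
    rw [hN.eq_zero r m (by omega) (by omega), hN.eq_zero (r + 1) m (by omega) (by omega)]
    simp

theorem maxWeight_tableauWeighting (hT : IsInterlacing n T) {k i : ℕ} (hk : k ≤ n) (hi : i ≤ k) :
    maxWeight n (tableauWeighting T) k i = T k i := by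
  refine le_antisymm ?_ ?_
  · obtain ⟨N, hN, h⟩ := exists_maxWeight_eq hk hi (tableauWeighting T)
    rw [h]
    exact hN.heightWeight_le hT hk hi
  · rw [← heightWeight_staircase hT hk hi]
    exact heightWeight_le_maxWeight hk hi (isHeight_staircase hi) _

/-- Supplies the compactness needed in the limit: first edges have weight `T r 1`, later out-edges
have weight at most `0` by interlacing, all others weight `0`. No lower bound is needed, as weights
may tend to `-∞`. -/
theorem tableauWeighting_le (hT : IsInterlacing n T) {M : ℝ} (h0 : 0 ≤ M)
    (hM : ∀ k, 0 < k → k ≤ n → T k 1 ≤ M) {e : (ℕ × ℕ) × (ℕ × ℕ)} (he : e ∈ edges n) :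
    tableauWeighting T e ≤ M := by
  rcases mem_edges_iff.1 he with ⟨r, m, hm, hr, rfl⟩ | ⟨r, m, hm, hr, rfl⟩ | ⟨r, m, hm, hr, rfl⟩
  · rw [tableauWeighting_outEdge]
    cases m with
    | zero =>
      simp only [outWeight, rowDiff, hT.zero r hr, zero_add, sub_zero]
      exact hM r hm hr
    | succ m =>
      obtain ⟨r, rfl⟩ : ∃ s, r = s + 1 := ⟨r - 1, by omega⟩
      have := hT.interlace r m (by omega) hr
      simp only [outWeight, rowDiff, Nat.add_sub_cancel] at *
      linarith
  · rwa [tableauWeighting_midEdge]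
  · rwa [tableauWeighting_slantEdge]

/-! ### Passing to the closure -/

/-- Extension of a tableau by zero. -/
noncomputable def extendTableau {n : ℕ} (t : TriNode n → ℝ) (k i : ℕ) : ℝ :=
  if h : i ≤ k ∧ k ≤ n then t ⟨(k, i), h⟩ else 0

theorem extendTableau_of_le {n : ℕ} (t : TriNode n → ℝ) {k i : ℕ} (h : i ≤ k ∧ k ≤ n) :
    extendTableau t k i = t ⟨(k, i), h⟩ := dif_pos h

/-- Subtraction of the first column from each column. -/
def normalize {n : ℕ} (t : TriNode n → ℝ) : TriNode n → ℝ :=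
  fun p => t p - t ⟨(p.1.1, 0), Nat.zero_le _, p.2.2⟩

/-- The inequalities of `C_2` only involve differences within rows, so they survive subtracting a
constant from each row. -/
theorem isInterlacing_normalize {n : ℕ} {t : TriNode n → ℝ} (ht : t ∈ coneC2 n) :
    IsInterlacing n (extendTableau (normalize t)) := by
  refine ⟨fun k hk => ?_, fun k m hm hk => ?_, fun k m hm hk => ?_⟩
  · rw [extendTableau_of_le _ ⟨Nat.zero_le k, hk⟩]
    simp [normalize]
  · have h := (ht k (m + 1) (by omega) hm hk).1
    rw [extendTableau_of_le _ (by omega), extendTableau_of_le _ (by omega),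
      extendTableau_of_le _ (by omega), extendTableau_of_le _ (by omega)]
    simp only [normalize, Nat.add_sub_cancel] at *
    linarith
  · have h := (ht k (m + 1) (by omega) hm hk).2
    rw [extendTableau_of_le _ (by omega), extendTableau_of_le _ (by omega),
      extendTableau_of_le _ (by omega), extendTableau_of_le _ (by omega)]
    simp only [normalize, Nat.add_sub_cancel] at *
    linarith

/-- A weighting that realizes the normalization of a tableau in `C_2`. -/
noncomputable def realization {n : ℕ} (t : TriNode n → ℝ) : (network n).Weighting :=
  (network n).realWeighting (tableauWeighting (extendTableau (normalize t)))

theorem L_realization {n : ℕ} {t : TriNode n → ℝ} (ht : t ∈ coneC2 n) :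
    (network n).L n (realization t) = tropTableau (normalize t) := by
  funext p
  have h := maxWeight_tableauWeighting (isInterlacing_normalize ht) p.2.2 p.2.1
  rw [extendTableau_of_le _ p.2] at h
  rw [tropTableau, ← show p = ⟨(p.1.1, p.1.2), p.2⟩ from rfl] at *
  rw [← h, coe_maxWeight p.2.2 p.2.1]
  rfl

/-- Normalization does not change limits whose first column vanishes. -/
theorem tendsto_normalize {n : ℕ} {F : Filter (TriNode n → ℝ)} {t : TriNode n → TropReal}
    (h : Tendsto tropTableau F (𝓝 t))
    (h0 : ∀ (k : ℕ) (hk : k ≤ n), t ⟨(k, 0), ⟨Nat.zero_le k, hk⟩⟩ = 0) :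
    Tendsto (fun s => tropTableau (normalize s)) F (𝓝 t) := by
  rw [tendsto_pi_nhds] at h ⊢
  intro p
  have hz := h ⟨(p.1.1, 0), Nat.zero_le _, p.2.2⟩
  rw [h0 p.1.1 p.2.2] at hz
  -- Tropical numbers cannot be subtracted in general, but the first column tends to the finite
  -- value `0`, so its convergence already holds in `ℝ`, where negation is available.
  have hz' : Tendsto (fun s : TriNode n → ℝ => s ⟨(p.1.1, 0), Nat.zero_le _, p.2.2⟩) F (𝓝 0) :=
    WithBot.isOpenEmbedding_coe.isInducing.tendsto_nhds_iff.2 hz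
  have hz'' : Tendsto (fun s : TriNode n → ℝ =>
      ((-s ⟨(p.1.1, 0), Nat.zero_le _, p.2.2⟩ : ℝ) : TropReal)) F (𝓝 ((-0 : ℝ) : TropReal)) :=
    (WithBot.continuous_coe.tendsto _).comp hz'.neg
  have hsum := (h p).add hz''
  simp only [neg_zero, WithBot.coe_zero, add_zero] at hsum
  refine hsum.congr fun s => ?_
  simp only [tropTableau, normalize, sub_eq_add_neg, WithBot.coe_add]

theorem closure_subset_range_L (n : ℕ) :
    closure (tropTableau '' coneC2 n) ∩
        {t | ∀ (k : ℕ) (hk : k ≤ n), t ⟨(k, 0), ⟨Nat.zero_le k, hk⟩⟩ = 0} ⊆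
      Set.range ((network n).L n) := by
  rintro t ⟨ht, h0⟩
  have hne : (comap tropTableau (𝓝 t) ⊓ 𝓟 (coneC2 n)).NeBot := by
    rwa [← map_neBot_iff tropTableau, Filter.push_pull', map_principal, ← ClusterPt,
      ← mem_closure_iff_clusterPt]
  -- An ultrafilter on the real cone converging to `t`: by compactness its image under `realization`
  -- converges without passing to subsequences.
  set U := Ultrafilter.of (comap tropTableau (𝓝 t) ⊓ 𝓟 (coneC2 n))
  have hU : (U : Filter (TriNode n → ℝ)) ≤ comap tropTableau (𝓝 t) ⊓ 𝓟 (coneC2 n) :=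
    Ultrafilter.of_le _
  have hcone : ∀ᶠ s in (U : Filter (TriNode n → ℝ)), s ∈ coneC2 n :=
    hU.trans inf_le_right (mem_principal_self _)
  have hlim : Tendsto (fun s => tropTableau (normalize s)) (U : Filter (TriNode n → ℝ)) (𝓝 t) :=
    tendsto_normalize (tendsto_iff_comap.2 (hU.trans inf_le_left)) h0
  have hfin : Finite (TriNode n) := by
    refine Set.Finite.to_subtype ((Set.finite_Iic (n, n)).subset ?_)
    rintro ⟨k, i⟩ ⟨h1, h2⟩
    dsimp only at h1 h2
    exact ⟨h2, by dsimp only; omega⟩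
  -- A strict bound on the finitely many entries of `t` holds eventually along `U`; `0 ≤ M` covers
  -- the edges of weight `0`.
  obtain ⟨M, hM0, hM⟩ : ∃ M : ℝ, 0 ≤ M ∧ ∀ p : TriNode n, t p < M := by
    have hp : ∀ p : TriNode n, ∃ c : ℝ, t p < c := fun p => by
      induction t p using WithBot.recBotCoe with
      | bot => exact ⟨0, WithBot.bot_lt_coe _⟩
      | coe r => exact ⟨r + 1, by exact_mod_cast lt_add_one r⟩
    choose c hc using hp
    obtain ⟨B, hB⟩ := (Set.finite_range c).bddAbove
    refine ⟨max B 0, le_max_right _ _, fun p => (hc p).trans_le ?_⟩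
    exact WithBot.coe_le_coe.2 ((hB ⟨p, rfl⟩).trans (le_max_left _ _))
  have hbound : ∀ᶠ s in (U : Filter (TriNode n → ℝ)),
      ∀ p : TriNode n, tropTableau (normalize s) p ≤ M :=
    eventually_all.2 fun p => ((tendsto_pi_nhds.1 hlim p).eventually (Iio_mem_nhds (hM p))).mono
      fun _ h => le_of_lt h
  have hmem : ∀ᶠ s in (U : Filter (TriNode n → ℝ)),
      realization s ∈ Set.univ.pi (fun _ : {e // e ∈ (network n).E} => Set.Iic (M : TropReal)) := by
    filter_upwards [hcone, hbound] with s hs hb e _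
    refine WithBot.coe_le_coe.2 (tableauWeighting_le (isInterlacing_normalize hs) hM0 ?_ e.2)
    intro k hk hkn
    rw [extendTableau_of_le _ ⟨hk, hkn⟩]
    exact WithBot.coe_le_coe.1 (hb _)
  have hcompact : IsCompact
      (Set.univ.pi (fun _ : {e // e ∈ (network n).E} => Set.Iic (M : TropReal))) :=
    isCompact_univ_pi fun _ => by rw [← Set.Icc_bot]; exact isCompact_Icc
  obtain ⟨ε, -, hε⟩ := hcompact.ultrafilter_le_nhds (U.map realization)
    (le_principal_iff.2 hmem)
  -- `L` of the realizations is the normalized tableau, which tends both to `L ε`, by continuity,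
  -- and to `t`.
  refine ⟨ε, tendsto_nhds_unique (f := fun s => tropTableau (normalize s))
    (l := (U : Filter (TriNode n → ℝ))) ?_ hlim⟩
  refine Tendsto.congr' (hcone.mono fun s hs => L_realization hs) ?_
  exact (((network n).continuous_L n).tendsto ε).comp hε

end TriangularNetwork

theorem theorem4p2 (n : ℕ) :
    Set.range ((TriangularNetwork.network n).L n) =
      closure (tropTableau '' coneC2 n) ∩
        {t | ∀ (k : ℕ) (hk : k ≤ n), t ⟨(k, 0), ⟨Nat.zero_le k, hk⟩⟩ = 0} := by
  refine Set.Subset.antisymm (Set.subset_inter ?_ ?_)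
    (TriangularNetwork.closure_subset_range_L n)
  · exact PlanarNetwork.range_L_subset_closure _ n _ (TriangularNetwork.L_realWeighting_mem n)
  · rintro _ ⟨ε, rfl⟩ k _
    simp [PlanarNetwork.L, PlanarNetwork.l]
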